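/- Let $k$ be a field and let $\mathcal C$ be a (skeletally small) $k$-linear additive category which is idempotent complete and Hom-finite, i.e. every $\mathrm{Hom}_{\mathcal C}(X,Y)$ is a finite-dimensional $k$-vector space. Let $G$ be a finite abelian group which splits over $k$, i.e. the group algebra $kG$ is isomorphic as a $k$-algebra to a finite product of copies of $k$. Fix a $k$-linear action of $G$ on $\mathcal C$: $k$-linear autoequivalences $F_g$ $(g\in G)$ of $\mathcal C$ and natural isomorphisms $\varepsilon_{g,h}\colon F_gF_h\to F_{gh}$ with $\varepsilon_{gh,l}\circ\varepsilon_{g,h}F_l=\varepsilon_{g,hl}\circ F_g\varepsilon_{h,l}$ for all $g,h,l\in G$. Let $\mathcal C^G$ be the category of $G$-equivariant objects $(X,\alpha)$, where $\alpha_g\colon X\to F_g(X)$ $(g\in G)$ are isomorphisms with $\alpha_{gh}=(\varepsilon_{g,h})_X\circ F_g(\alpha_h)\circ\alpha_g$; a morphism $(X,\alpha)\to(Y,\beta)$ is a morphism $f\colon X\to Y$ with $\beta_g\circ f=F_g(f)\circ\alpha_g$ for all $g$. The induction functor $\mathrm{Ind}\colon\mathcal C\to\mathcal C^G$ sends $X$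 to $\bigoplus_{h\in G}F_h(X)$, with structure isomorphisms $\bigoplus_hF_h(X)\to F_g(\bigoplus_hF_h(X))$ given diagonally by $(\varepsilon_{g,g^{-1}h})_X^{-1}\colon F_h(X)\to F_gF_{g^{-1}h}(X)$. The character group $\widehat G=\mathrm{Hom}(G,k^*)$ acts strictly on $\mathcal C^G$ by $F_\chi(X,\alpha)=(X,(\chi(g^{-1})\alpha_g)_{g\in G})$, with $F_\chi$ the identity on morphisms (the dual action). For a group $H$ acting $k$-linearly on a $k$-linear additive category $\mathcal D$ by $\{F_h,\varepsilon_{h,h'}\}$: * $\mathrm{Aut}(\mathcal D;H)$ is the group of isomorphism classes of $k$-linear $H$-equivariant autoequivalences $(F,\delta)$, i.e. $k$-linear autoequivalences $F$ of $\mathcal D$ with natural isomorphisms $\delta_h\colon FF_h\to F_hF$ satisfying $\delta_{hh'}\circ F\varepsilon_{h,h'}=\varepsilon_{h,h'}F\circ F_h\delta_{h'}\circ\delta_hF_{h'}$. An isomorphism $(F,\delta)\to(F',\delta')$ is a natural isomorphism $\phi\colon F\to F'$ with $F_h\phi\circ\delta_h=\delta'_h\circ\phi F_h$, and multiplication is induced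 by $(F,\delta)(F',\delta')=(FF',(\delta_hF'\circ F\delta'_h)_h)$. * An object $M$ is basic if it is a finite direct sum of pairwise non-isomorphic indecomposable objects (the zero object is allowed), and $H$-stable if $F_h(M)\simeq M$ for all $h\in H$. $\mathrm{Stab}^H(\mathcal D)$ is the set of isomorphism classes of basic $H$-stable objects, on which $\mathrm{Aut}(\mathcal D;H)$ acts by $[F,\delta].M=F(M)$. * $\mathrm{add}\,M$ is the full subcategory of direct summands of finite direct sums of copies of $M$. Then there is a bijection $$\iota\colon \mathrm{Stab}^G(\mathcal C)\longrightarrow\mathrm{Stab}^{\widehat G}(\mathcal C^G)$$ such that $\mathrm{add}\,\iota(M)=\mathrm{add}\,\mathrm{Ind}(M)$ for every $M\in\mathrm{Stab}^G(\mathcal C)$. Moreover, $\iota$ induces a bijection on orbit sets $$\mathrm{Stab}^G(\mathcal C)/\mathrm{Aut}(\mathcal C;G)\longrightarrow\mathrm{Stab}^{\widehat G}(\mathcal C^G)/\mathrm{Aut}(\mathcal C^G;\widehat G).$$ -/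

import Mathlib

open CategoryTheory CategoryTheory.Limits

universe w w' v u

noncomputable section

namespace Equivariantization

theorem total' {D : Type*} [Category* D] [Preadditive D] {J : Type*} [Fintype J] (f : J → D)
    [HasBiproduct f] : ∑ j, biproduct.π f j ≫ biproduct.ι f j = 𝟙 (⨁ f) := by
  classical
  apply biproduct.hom_ext
  intro i
  simp only [Preadditive.sum_comp, Category.assoc, Category.id_comp]
  rw [Finset.sum_eq_single i]
  · simp
  · intro j _ hj
    rw [biproduct.ι_π_ne _ hj, comp_zero]
  · simp

theorem lift_desc' {D : Type*} [Category* D] [Preadditive D] {J : Type*} [Fintype J] (f : J → D)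
    [HasBiproduct f] {X Y : D} (a : ∀ j, X ⟶ f j) (b : ∀ j, f j ⟶ Y) :
    biproduct.lift a ≫ biproduct.desc b = ∑ j, a j ≫ b j := by
  rw [← Category.id_comp (biproduct.desc b), ← total', Preadditive.sum_comp,
    Preadditive.comp_sum]
  simp

/-- An additive functor commutes with finite direct sums. -/
@[simps]
def mapSumIso {D : Type*} [Category* D] [Preadditive D] [HasFiniteBiproducts D]
    {E : Type*} [Category* E] [Preadditive E] [HasFiniteBiproducts E] (F : D ⥤ E) [F.Additive]
    {J : Type*} [Finite J] (f : J → D) : F.obj (⨁ f) ≅ ⨁ fun j => F.obj (f j) where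
  hom := biproduct.lift fun j => F.map (biproduct.π f j)
  inv := biproduct.desc fun j => F.map (biproduct.ι f j)
  hom_inv_id := by
    cases nonempty_fintype J
    rw [lift_desc']
    simp only [← Functor.map_comp]
    rw [← Functor.map_sum, total', CategoryTheory.Functor.map_id]
  inv_hom_id := by
    classical
    apply biproduct.hom_ext'
    intro i
    apply biproduct.hom_ext
    intro j
    simp only [biproduct.ι_desc_assoc, Category.assoc, biproduct.lift_π, ← Functor.map_comp,
      Category.comp_id, biproduct.ι_π]
    split_ifs with h
    · subst h; simp
    · simp

theorem mapSumIso_inv_π {D : Type*} [Category* D] [Preadditive D] [HasFiniteBiproducts D]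
    {E : Type*} [Category* E] [Preadditive E] [HasFiniteBiproducts E] (F : D ⥤ E) [F.Additive]
    {J : Type*} [Finite J] (f : J → D) (j : J) :
    (mapSumIso F f).inv ≫ F.map (biproduct.π f j) = biproduct.π (fun j => F.obj (f j)) j := by
  rw [Iso.inv_comp_eq]; simp

/-- Morphisms into `F (⨁ f)` are determined by their components. -/
theorem hom_ext_map_sum {D : Type*} [Category* D] [Preadditive D] [HasFiniteBiproducts D]
    {E : Type*} [Category* E] [Preadditive E] [HasFiniteBiproducts E] (F : D ⥤ E) [F.Additive]
    {J : Type*} [Finite J] (f : J → D) {Z : E} {a b : Z ⟶ F.obj (⨁ f)}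
    (h : ∀ j, a ≫ F.map (biproduct.π f j) = b ≫ F.map (biproduct.π f j)) : a = b := by
  rw [← cancel_mono (mapSumIso F f).hom]
  apply biproduct.hom_ext
  intro j
  simpa using h j

/-- A `k`-linear action of a group `G` on a `k`-linear category `C`: `k`-linear autoequivalences
`F g` and natural isomorphisms `ε g h : F_g F_h ≅ F_{gh}` subject to the 2-cocycle condition
`ε_{gh,l} ∘ ε_{g,h} F_l = ε_{g,hl} ∘ F_g ε_{h,l}`.  (The natural isomorphisms are given
by their components; the `eqToHom` identifies `F_{(gh)l} X` with `F_{g(hl)} X`.) -/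
structure LinearAction (k : Type w) [Field k] (G : Type w') [Group G]
    (C : Type u) [Category.{v} C] [Preadditive C] [Linear k C] where
  F : G → C ⥤ C
  additive : ∀ g, (F g).Additive
  linear : ∀ g, (F g).Linear k
  isEquivalence : ∀ g, (F g).IsEquivalence
  ε : ∀ (g h : G) (X : C), (F g).obj ((F h).obj X) ≅ (F (g * h)).obj X
  ε_naturality : ∀ (g h : G) {X Y : C} (f : X ⟶ Y),
    (F g).map ((F h).map f) ≫ (ε g h Y).hom = (ε g h X).hom ≫ (F (g * h)).map f
  cocycle : ∀ (g h l : G) (X : C),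
    (ε g h ((F l).obj X)).hom ≫ (ε (g * h) l X).hom ≫
        eqToHom (congrArg (fun a => (F a).obj X) (mul_assoc g h l)) =
      (F g).map (ε h l X).hom ≫ (ε g (h * l) X).hom

attribute [instance] LinearAction.additive LinearAction.linear LinearAction.isEquivalence

section Equivariant

variable {k : Type w} [Field k] {G : Type w'} [Group G]
  {C : Type u} [Category.{v} C] [Preadditive C] [Linear k C]

/-- A `G`-equivariant object `(X, α)`: isomorphisms `α_g : X ≅ F_g X` such that
`α_{gh} = (ε_{g,h})_X ∘ F_g(α_h) ∘ α_g`. -/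
structure EquivariantObject (A : LinearAction k G C) where
  X : C
  α : ∀ g, X ≅ (A.F g).obj X
  α_mul : ∀ g h, (α (g * h)).hom =
    (α g).hom ≫ (A.F g).map (α h).hom ≫ (A.ε g h X).hom

namespace EquivariantObject

variable {A : LinearAction k G C}

/-- A morphism `(X, α) ⟶ (Y, β)` is a morphism `f : X ⟶ Y` with `β_g ∘ f = F_g(f) ∘ α_g`. -/
@[ext]
structure Hom (P Q : EquivariantObject A) where
  f : P.X ⟶ Q.X
  comm : ∀ g, f ≫ (Q.α g).hom = (P.α g).hom ≫ (A.F g).map f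

instance : Category.{v} (EquivariantObject A) where
  Hom P Q := Hom P Q
  id P := ⟨𝟙 P.X, fun g => by simp⟩
  comp a b := ⟨a.f ≫ b.f, fun g => by
    rw [Category.assoc, b.comm, ← Category.assoc, a.comm, Category.assoc, Functor.map_comp]⟩

@[ext]
theorem hom_ext {P Q : EquivariantObject A} {a b : P ⟶ Q} (h : a.f = b.f) : a = b :=
  Hom.ext h

@[simp]
theorem id_f (P : EquivariantObject A) : Hom.f (𝟙 P) = 𝟙 P.X := rfl

@[simp]
theorem comp_f {P Q R : EquivariantObject A} (a : P ⟶ Q) (b : Q ⟶ R) :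
    (a ≫ b).f = a.f ≫ b.f := rfl

instance (P Q : EquivariantObject A) : Zero (P ⟶ Q) := ⟨⟨0, fun g => by simp⟩⟩

instance (P Q : EquivariantObject A) : Add (P ⟶ Q) :=
  ⟨fun a b => ⟨a.f + b.f, fun g => by
    simp [Functor.map_add, a.comm, b.comm]⟩⟩

instance (P Q : EquivariantObject A) : Neg (P ⟶ Q) :=
  ⟨fun a => ⟨-a.f, fun g => by simp [a.comm]⟩⟩

instance (P Q : EquivariantObject A) : Sub (P ⟶ Q) :=
  ⟨fun a b => ⟨a.f - b.f, fun g => by simp [a.comm, b.comm, Functor.map_sub]⟩⟩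

instance (P Q : EquivariantObject A) : SMul ℕ (P ⟶ Q) :=
  ⟨fun n a => ⟨n • a.f, fun g => by
    simp [a.comm]⟩⟩

instance (P Q : EquivariantObject A) : SMul ℤ (P ⟶ Q) :=
  ⟨fun n a => ⟨n • a.f, fun g => by
    simp [a.comm]⟩⟩

instance (P Q : EquivariantObject A) : SMul k (P ⟶ Q) :=
  ⟨fun r a => ⟨r • a.f, fun g => by simp [a.comm, Functor.map_smul]⟩⟩

theorem f_injective (P Q : EquivariantObject A) :
    Function.Injective (fun a : P ⟶ Q => a.f) := fun _ _ h => hom_ext h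

instance (P Q : EquivariantObject A) : AddCommGroup (P ⟶ Q) :=
  Function.Injective.addCommGroup (fun a : P ⟶ Q => a.f) (f_injective P Q) rfl
    (fun _ _ => rfl) (fun _ => rfl) (fun _ _ => rfl) (fun _ _ => rfl) (fun _ _ => rfl)

@[simp]
theorem add_f {P Q : EquivariantObject A} (a b : P ⟶ Q) : (a + b).f = a.f + b.f := rfl

@[simp]
theorem zero_f (P Q : EquivariantObject A) : Hom.f (0 : P ⟶ Q) = 0 := rfl

@[simp]
theorem smul_f {P Q : EquivariantObject A} (r : k) (a : P ⟶ Q) : (r • a).f = r • a.f := rfl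

/-- The underlying-morphism map, as an additive homomorphism. -/
def fHom (P Q : EquivariantObject A) : (P ⟶ Q) →+ (P.X ⟶ Q.X) where
  toFun a := a.f
  map_zero' := rfl
  map_add' _ _ := rfl

instance : Preadditive (EquivariantObject A) where
  add_comp _ _ _ a b c := by ext; simp
  comp_add _ _ _ a b c := by ext; simp

instance (P Q : EquivariantObject A) : Module k (P ⟶ Q) :=
  Function.Injective.module k (fHom P Q) (f_injective P Q) (fun _ _ => rfl)

instance : Linear k (EquivariantObject A) where
  smul_comp _ _ _ r a b := by ext; simp
  comp_smul _ _ _ a r b := by ext; simp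

/-- An isomorphism of underlying objects which is equivariant is an isomorphism. -/
@[simps]
def mkIso {P Q : EquivariantObject A} (e : P.X ≅ Q.X)
    (h : ∀ g, e.hom ≫ (Q.α g).hom = (P.α g).hom ≫ (A.F g).map e.hom) : P ≅ Q where
  hom := ⟨e.hom, h⟩
  inv := ⟨e.inv, fun g => by
    rw [Iso.inv_comp_eq, ← Category.assoc, h, Category.assoc, ← Functor.map_comp]
    simp⟩
  hom_inv_id := by ext; simp
  inv_hom_id := by ext; simp

section Biproducts

variable [HasFiniteBiproducts C]

/-- The isomorphism `⨁ X_j ≅ F_g (⨁ X_j)` given diagonally by the `(α_j)_g`. -/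
def sumIso {J : Type*} [Finite J] (P : J → EquivariantObject A) (g : G) :
    (⨁ fun j => (P j).X) ≅ (A.F g).obj (⨁ fun j => (P j).X) :=
  biproduct.mapIso (fun j => (P j).α g) ≪≫ (mapSumIso (A.F g) (fun j => (P j).X)).symm

theorem sumIso_π {J : Type*} [Finite J] (P : J → EquivariantObject A) (g : G) (j : J) :
    (sumIso P g).hom ≫ (A.F g).map (biproduct.π (fun j => (P j).X) j) =
      biproduct.π (fun j => (P j).X) j ≫ ((P j).α g).hom := by
  rw [sumIso, Iso.trans_hom, Category.assoc, Iso.symm_hom, mapSumIso_inv_π]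
  simp

/-- The direct sum of a finite family of equivariant objects. -/
abbrev sum {J : Type*} [Finite J] (P : J → EquivariantObject A) : EquivariantObject A where
  X := ⨁ fun j => (P j).X
  α g := sumIso P g
  α_mul g h := by
    apply hom_ext_map_sum
    intro j
    rw [sumIso_π, Category.assoc, Category.assoc, ← A.ε_naturality, (P j).α_mul,
      ← Functor.map_comp_assoc, sumIso_π, Functor.map_comp_assoc, ← Category.assoc,
      ← Category.assoc, ← sumIso_π]
    simp only [Category.assoc]

open scoped Classical in
/-- `sum P` is a biproduct of the family `P`. -/
def sumBicone {J : Type*} [Finite J] (P : J → EquivariantObject A) : Bicone P where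
  pt := sum P
  π j := ⟨biproduct.π (fun j => (P j).X) j, fun g => (sumIso_π P g j).symm⟩
  ι j := ⟨biproduct.ι (fun j => (P j).X) j, fun g => by
    apply hom_ext_map_sum
    intro i
    rw [Category.assoc, Category.assoc, sumIso_π, ← Functor.map_comp]
    by_cases hij : j = i
    · subst hij; simp
    · rw [biproduct.ι_π_ne_assoc _ hij, biproduct.ι_π_ne _ hij]; simp⟩
  ι_π j j' := by
    ext
    by_cases hij : j = j'
    · subst hij
      simp
    · simp [hij]

instance : HasFiniteBiproducts (EquivariantObject A) where
  out n := ⟨fun P => hasBiproduct_of_total (sumBicone P) (by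
    ext
    have hs : ∀ (s : Finset (Fin n)) (a : Fin n → ((sumBicone P).pt ⟶ (sumBicone P).pt)),
        (∑ j ∈ s, a j).f = ∑ j ∈ s, (a j).f := fun s a =>
      map_sum (fHom (sumBicone P).pt (sumBicone P).pt) a s
    rw [hs]
    exact biproduct.total (f := fun j => (P j).X))⟩

end Biproducts

end EquivariantObject

section Induction

variable [HasFiniteBiproducts C] [Finite G]

/-- The diagonal isomorphism `⨁_h F_h X ≅ ⨁_h F_g F_h X` with components
`(ε_{g,h})_X⁻¹ : F_{gh} X ≅ F_g F_h X`. -/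
@[simps]
def shiftIso (A : LinearAction k G C) (X : C) (g : G) :
    (⨁ fun h => (A.F h).obj X) ≅ ⨁ fun h => (A.F g).obj ((A.F h).obj X) where
  hom := biproduct.lift fun h => biproduct.π (fun h => (A.F h).obj X) (g * h) ≫ (A.ε g h X).inv
  inv := biproduct.desc fun h => (A.ε g h X).hom ≫ biproduct.ι (fun h => (A.F h).obj X) (g * h)
  hom_inv_id := by
    cases nonempty_fintype G
    rw [lift_desc']
    simp only [Category.assoc, Iso.inv_hom_id_assoc]
    rw [← total']
    exact Fintype.sum_equiv (Equiv.mulLeft g) _ (fun h => biproduct.π _ h ≫ biproduct.ι _ h)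
      (fun h => rfl)
  inv_hom_id := by
    apply biproduct.hom_ext'
    intro i
    apply biproduct.hom_ext
    intro j
    simp only [biproduct.ι_desc_assoc, Category.assoc, biproduct.lift_π, Category.comp_id]
    by_cases hij : i = j
    · subst hij; simp
    · rw [biproduct.ι_π_ne_assoc _ (fun h => hij (mul_left_cancel h)), biproduct.ι_π_ne _ hij]
      simp

/-- The isomorphism `ε(X)_g : ⨁_h F_h X ≅ F_g (⨁_h F_h X)`, given diagonally by
`(ε_{g,h})_X⁻¹ : F_{gh} X ≅ F_g F_h X`. -/
def indIso (A : LinearAction k G C) (X : C) (g : G) :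
    (⨁ fun h => (A.F h).obj X) ≅ (A.F g).obj (⨁ fun h => (A.F h).obj X) :=
  shiftIso A X g ≪≫ (mapSumIso (A.F g) (fun h => (A.F h).obj X)).symm

theorem indIso_π (A : LinearAction k G C) (X : C) (g h : G) :
    (indIso A X g).hom ≫ (A.F g).map (biproduct.π (fun h => (A.F h).obj X) h) =
      biproduct.π (fun h => (A.F h).obj X) (g * h) ≫ (A.ε g h X).inv := by
  rw [indIso, Iso.trans_hom, Category.assoc, Iso.symm_hom, mapSumIso_inv_π]
  simp

/-- The induced object `Ind X = (⨁_h F_h X, ε(X))`. -/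
abbrev indObj (A : LinearAction k G C) (X : C) : EquivariantObject A where
  X := ⨁ fun h => (A.F h).obj X
  α := indIso A X
  α_mul g h := by
    apply hom_ext_map_sum
    intro l
    have coc := A.cocycle g h l X
    have cast := biproduct.π_comp_eqToHom (fun h => (A.F h).obj X) (mul_assoc g h l)
    rw [indIso_π, Category.assoc, Category.assoc, ← A.ε_naturality, ← Functor.map_comp_assoc,
      indIso_π, Functor.map_comp_assoc, ← Category.assoc, indIso_π, Category.assoc,
      ← cast, Category.assoc]
    congr 1
    rw [← cancel_epi (A.ε (g * h) l X).hom, Iso.hom_inv_id,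
      ← cancel_epi (A.ε g h ((A.F l).obj X)).hom, reassoc_of% coc]
    simp [← Functor.map_comp_assoc]

/-- The induction functor, `Ind X = (⨁_h F_h X, ε(X))` and `Ind θ = ⨁_h F_h θ`. -/
def inductionFunctor (A : LinearAction k G C) : C ⥤ EquivariantObject A where
  obj X := indObj A X
  map {X Y} θ :=
    { f := biproduct.map fun h => (A.F h).map θ
      comm := fun g => by
        apply hom_ext_map_sum
        intro l
        rw [Category.assoc, indIso_π, Category.assoc, ← Functor.map_comp, biproduct.map_π,
          Functor.map_comp, ← Category.assoc, ← Category.assoc, indIso_π, biproduct.map_π,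
          Category.assoc, Category.assoc]
        congr 1
        rw [Iso.comp_inv_eq, Category.assoc, A.ε_naturality, Iso.inv_hom_id_assoc] }
  map_id X := by
    ext
    simp
  map_comp a b := by
    ext
    simp

end Induction

section DualAction

/-- The object `F_χ (X, α) = (X, χ ⊗ α)`, where `(χ ⊗ α)_g = χ(g⁻¹) α_g`. -/
abbrev twistObj {A : LinearAction k G C} (χ : G →* kˣ) (P : EquivariantObject A) :
    EquivariantObject A where
  X := P.X
  α g :=
    { hom := (χ g⁻¹ : k) • (P.α g).hom
      inv := (χ g : k) • (P.α g).inv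
      hom_inv_id := by simp [smul_smul]
      inv_hom_id := by simp [smul_smul] }
  α_mul g h := by
    simp [P.α_mul, smul_smul, mul_comm]

/-- The automorphism `F_χ` of the category of equivariant objects, identity on morphisms. -/
def twist (A : LinearAction k G C) (χ : G →* kˣ) :
    EquivariantObject A ⥤ EquivariantObject A where
  obj P := twistObj χ P
  map a := ⟨a.f, fun g => by simp [a.comm]⟩

theorem eqToHom_f {A : LinearAction k G C} (P : EquivariantObject A) {χ ψ : G →* kˣ}
    (h : χ = ψ) : (eqToHom (congrArg (fun χ => (twist A χ).obj P) h)).f = 𝟙 P.X := by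
  subst h; rfl

instance (A : LinearAction k G C) (χ : G →* kˣ) : (twist A χ).Additive where
  map_add := rfl

instance (A : LinearAction k G C) (χ : G →* kˣ) : (twist A χ).Linear k where
  map_smul _ _ := rfl

instance (A : LinearAction k G C) (χ : G →* kˣ) : (twist A χ).IsEquivalence where
  faithful := ⟨fun h => EquivariantObject.hom_ext (congrArg (fun a => EquivariantObject.Hom.f a) h :)⟩
  full := ⟨fun {P Q} b => ⟨⟨b.f, fun g => by
    let f : P.X ⟶ Q.X := b.f
    have this : f ≫ ((χ g⁻¹ : k) • (Q.α g).hom) =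
      ((χ g⁻¹ : k) • (P.α g).hom) ≫ (A.F g).map f := b.comm g
    rw [Linear.comp_smul, Linear.smul_comp] at this
    exact smul_right_injective _ (χ g⁻¹).ne_zero this⟩, rfl⟩⟩
  essSurj := ⟨fun P => ⟨twistObj χ⁻¹ P, ⟨EquivariantObject.mkIso (Iso.refl P.X) (fun g => by
    simp [twist, smul_smul])⟩⟩⟩

/-- The dual action of the character group `Ĝ = Hom(G, kˣ)` on the category of `G`-equivariant
objects.  It is strict: `F_χ F_ψ = F_{χψ}`, and the structure isomorphisms are given by identity maps. -/
def dualAction (A : LinearAction k G C) :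
    LinearAction k (G →* kˣ) (EquivariantObject A) where
  F χ := twist A χ
  additive _ := inferInstance
  linear _ := inferInstance
  isEquivalence _ := inferInstance
  ε χ ψ P := EquivariantObject.mkIso (Iso.refl P.X) (fun g => by
    simp [twist, smul_smul])
  ε_naturality χ ψ P Q a := by
    ext
    exact (Category.comp_id a.f).trans (Category.id_comp a.f).symm
  cocycle χ ψ ω P := by
    ext
    rw [EquivariantObject.comp_f, EquivariantObject.comp_f, eqToHom_f P (mul_assoc χ ψ ω)]
    change 𝟙 P.X ≫ 𝟙 P.X ≫ 𝟙 P.X = 𝟙 P.X ≫ 𝟙 P.X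
    simp

end DualAction

section Autoequivalences

theorem inv_additive {D : Type*} [Category* D] [Preadditive D] (F : D ⥤ D) [hF : F.Additive]
    [F.IsEquivalence] : F.inv.Additive :=
  haveI : F.asEquivalence.functor.Additive := hF
  F.asEquivalence.inverse_additive

/-- A `k`-linear `G`-equivariant autoequivalence `(F, δ)`, where the natural isomorphisms
`δ_g : F F_g ≅ F_g F` satisfy `δ_{gh} ∘ F ε_{g,h} = ε_{g,h} F ∘ F_g δ_h ∘ δ_g F_h`. -/
structure EquivariantAutoequiv (A : LinearAction k G C) where
  F : C ⥤ C
  additive : F.Additive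
  linear : F.Linear k
  isEquivalence : F.IsEquivalence
  δ : ∀ (g : G) (X : C), F.obj ((A.F g).obj X) ≅ (A.F g).obj (F.obj X)
  δ_naturality : ∀ (g : G) {X Y : C} (f : X ⟶ Y),
    F.map ((A.F g).map f) ≫ (δ g Y).hom = (δ g X).hom ≫ (A.F g).map (F.map f)
  δ_mul : ∀ (g h : G) (X : C),
    F.map (A.ε g h X).hom ≫ (δ (g * h) X).hom =
      (δ g ((A.F h).obj X)).hom ≫ (A.F g).map (δ h X).hom ≫ (A.ε g h (F.obj X)).hom

namespace EquivariantAutoequiv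

attribute [instance] EquivariantAutoequiv.additive EquivariantAutoequiv.linear
  EquivariantAutoequiv.isEquivalence

variable {A : LinearAction k G C}

/-- The identity, with identity structure isomorphisms. -/
def one (A : LinearAction k G C) : EquivariantAutoequiv A where
  F := 𝟭 C
  additive := inferInstance
  linear := inferInstance
  isEquivalence := inferInstance
  δ g X := Iso.refl ((A.F g).obj X)
  δ_naturality g X Y f := by simp
  δ_mul g h X := by simp

/-- The composite `(F, δ)(F', δ') = (FF', (δ_g F' ∘ F δ'_g)_g)`. -/
def mul (P Q : EquivariantAutoequiv A) : EquivariantAutoequiv A where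
  F := Q.F ⋙ P.F
  additive := inferInstance
  linear := inferInstance
  isEquivalence := inferInstance
  δ g X := P.F.mapIso (Q.δ g X) ≪≫ P.δ g (Q.F.obj X)
  δ_naturality g X Y f := by
    have h1 := P.δ_naturality g (Q.F.map f)
    simp only [Functor.comp_map, Iso.trans_hom, Functor.mapIso_hom, Category.assoc]
    rw [← Functor.map_comp_assoc, Q.δ_naturality, Functor.map_comp_assoc, h1]
  δ_mul g h X := by
    have h1 := P.δ_mul g h (Q.F.obj X)
    have h2 := P.δ_naturality g (Q.δ h X).hom
    simp only [Functor.comp_obj, Functor.comp_map, Iso.trans_hom, Functor.mapIso_hom,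
      Functor.map_comp, Category.assoc]
    rw [← Functor.map_comp_assoc, Q.δ_mul]
    simp only [Functor.map_comp, Category.assoc]
    rw [h1, reassoc_of% h2]

/-- Isomorphism of equivariant autoequivalences: a natural isomorphism `φ : F ≅ F'` such that
`F_g φ ∘ δ_g = δ'_g ∘ φ F_g`. -/
def IsIsomorphic (P Q : EquivariantAutoequiv A) : Prop :=
  ∃ φ : P.F ≅ Q.F, ∀ (g : G) (X : C),
    (P.δ g X).hom ≫ (A.F g).map (φ.hom.app X) =
      φ.hom.app ((A.F g).obj X) ≫ (Q.δ g X).hom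

instance setoid (A : LinearAction k G C) : Setoid (EquivariantAutoequiv A) where
  r := IsIsomorphic
  iseqv :=
    { refl := fun P => ⟨Iso.refl _, fun g X => by simp⟩
      symm := by
        rintro P Q ⟨φ, hφ⟩
        refine ⟨φ.symm, fun g X => ?_⟩
        have := hφ g X
        rw [← cancel_epi (φ.hom.app ((A.F g).obj X)), ← reassoc_of% this]
        simp [← Functor.map_comp]
      trans := by
        rintro P Q R ⟨φ, hφ⟩ ⟨ψ, hψ⟩
        refine ⟨φ ≪≫ ψ, fun g X => ?_⟩
        simp [reassoc_of% (hφ g X), hψ g X] }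

theorem mul_congr {P P' Q Q' : EquivariantAutoequiv A} (h : P ≈ P') (h' : Q ≈ Q') :
    mul P Q ≈ mul P' Q' := by
  obtain ⟨φ, hφ⟩ := h
  obtain ⟨ψ, hψ⟩ := h'
  refine ⟨Functor.isoWhiskerRight ψ P.F ≪≫ Functor.isoWhiskerLeft Q'.F φ, fun g X => ?_⟩
  have h1 := hφ g (Q'.F.obj X)
  have h2 := P.δ_naturality g (ψ.hom.app X)
  have h3 := φ.hom.naturality (Q'.δ g X).hom
  simp only [mul, Functor.comp_obj, Iso.trans_hom, Functor.mapIso_hom, NatTrans.comp_app,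
    Functor.isoWhiskerRight_hom, Functor.whiskerRight_app, Functor.isoWhiskerLeft_hom,
    Functor.whiskerLeft_app, Functor.map_comp, Category.assoc]
  rw [← reassoc_of% h2, h1, ← reassoc_of% h3, ← Functor.map_comp_assoc, hψ,
    Functor.map_comp_assoc]

/-- The counit `F F⁻¹ X ≅ X` of a quasi-inverse. -/
def counit (P : EquivariantAutoequiv A) (X : C) : P.F.obj (P.F.inv.obj X) ≅ X :=
  P.F.asEquivalence.counitIso.app X

theorem counit_nat (P : EquivariantAutoequiv A) {X Y : C} (f : X ⟶ Y) :
    P.F.map (P.F.inv.map f) ≫ (P.counit Y).hom = (P.counit X).hom ≫ f :=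
  P.F.asEquivalence.counitIso.hom.naturality f

/-- The structure isomorphisms of the quasi-inverse of an equivariant autoequivalence. -/
def invδ (P : EquivariantAutoequiv A) (g : G) (X : C) :
    P.F.inv.obj ((A.F g).obj X) ≅ (A.F g).obj (P.F.inv.obj X) :=
  P.F.preimageIso (P.counit ((A.F g).obj X) ≪≫
    (A.F g).mapIso (P.counit X).symm ≪≫ (P.δ g (P.F.inv.obj X)).symm)

theorem map_invδ (P : EquivariantAutoequiv A) (g : G) (X : C) :
    P.F.map (P.invδ g X).hom ≫ (P.δ g (P.F.inv.obj X)).hom ≫ (A.F g).map (P.counit X).hom =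
      (P.counit ((A.F g).obj X)).hom := by
  simp [invδ, ← Functor.map_comp]

theorem inv_ext (P : EquivariantAutoequiv A) {g : G} {X Z : C}
    {a b : Z ⟶ (A.F g).obj (P.F.inv.obj X)}
    (h : P.F.map a ≫ (P.δ g (P.F.inv.obj X)).hom ≫ (A.F g).map (P.counit X).hom =
      P.F.map b ≫ (P.δ g (P.F.inv.obj X)).hom ≫ (A.F g).map (P.counit X).hom) : a = b := by
  apply P.F.map_injective
  rwa [cancel_mono] at h

/-- The quasi-inverse of an equivariant autoequivalence. -/
def inv (P : EquivariantAutoequiv A) : EquivariantAutoequiv A where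
  F := P.F.inv
  additive := inv_additive P.F
  linear := ⟨fun {X Y} f r => P.F.map_injective (by
    rw [← cancel_mono (P.counit Y).hom, counit_nat, Functor.map_smul, Linear.smul_comp,
      counit_nat, Linear.comp_smul])⟩
  isEquivalence := inferInstance
  δ := P.invδ
  δ_naturality g X Y f := by
    apply P.inv_ext
    rw [Functor.map_comp_assoc, map_invδ, Functor.map_comp_assoc,
      reassoc_of% P.δ_naturality g (P.F.inv.map f), ← Functor.map_comp, counit_nat, counit_nat,
      Functor.map_comp, reassoc_of% P.map_invδ g X]
  δ_mul g h X := by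
    apply P.inv_ext
    rw [Functor.map_comp_assoc, map_invδ, counit_nat, Functor.map_comp_assoc,
      Functor.map_comp_assoc, reassoc_of% P.δ_mul g h (P.F.inv.obj X), ← A.ε_naturality,
      reassoc_of% P.δ_naturality g (P.invδ h X).hom, ← Functor.map_comp_assoc,
      ← Functor.map_comp_assoc, Category.assoc, map_invδ, reassoc_of% P.map_invδ g]

/-- The inverse unit `F⁻¹ F X ≅ X` of a quasi-inverse. -/
def unitInv (P : EquivariantAutoequiv A) (X : C) : P.F.inv.obj (P.F.obj X) ≅ X :=
  (P.F.asEquivalence.unitIso.app X).symm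

theorem map_unitInv (P : EquivariantAutoequiv A) (X : C) :
    P.F.map (P.unitInv X).hom = (P.counit (P.F.obj X)).hom :=
  (P.F.asEquivalence.counit_app_functor X).symm

theorem inv_mul_equiv (P : EquivariantAutoequiv A) : mul (inv P) P ≈ one A := by
  refine ⟨P.F.asEquivalence.unitIso.symm, fun g X => ?_⟩
  have key : (P.F.inv.map (P.δ g X).hom ≫ (P.invδ g (P.F.obj X)).hom) ≫
      (A.F g).map (P.unitInv X).hom = (P.unitInv ((A.F g).obj X)).hom := by
    apply P.F.map_injective
    rw [← cancel_mono (P.δ g X).hom, Functor.map_comp, Category.assoc, P.δ_naturality,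
      map_unitInv, map_unitInv, ← counit_nat, ← map_invδ, Functor.map_comp, Category.assoc]
  exact key.trans (Category.comp_id _).symm

end EquivariantAutoequiv

/-- The group `Aut(C; G)` of isomorphism classes of `k`-linear `G`-equivariant autoequivalences,
with multiplication induced by composition. -/
def EquivariantAut (A : LinearAction k G C) := Quotient (EquivariantAutoequiv.setoid A)

namespace EquivariantAut

variable (A : LinearAction k G C)

instance : Monoid (EquivariantAut A) where
  mul := Quotient.map₂ EquivariantAutoequiv.mul
    (fun _ _ h _ _ h' => EquivariantAutoequiv.mul_congr h h')
  one := Quotient.mk _ (EquivariantAutoequiv.one A)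
  mul_assoc := by
    rintro ⟨P⟩ ⟨Q⟩ ⟨R⟩
    exact Quotient.sound ⟨Iso.refl _, fun g X => by simp [EquivariantAutoequiv.mul]⟩
  one_mul := by
    rintro ⟨P⟩
    exact Quotient.sound ⟨Iso.refl _, fun g X => by
      simp [EquivariantAutoequiv.mul, EquivariantAutoequiv.one]⟩
  mul_one := by
    rintro ⟨P⟩
    exact Quotient.sound ⟨Iso.refl _, fun g X => by
      simp [EquivariantAutoequiv.mul, EquivariantAutoequiv.one]⟩

theorem exists_left_inv (a : EquivariantAut A) : ∃ b : EquivariantAut A, b * a = 1 := by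
  obtain ⟨P⟩ := a
  exact ⟨Quotient.mk _ P.inv, Quotient.sound P.inv_mul_equiv⟩

instance : Group (EquivariantAut A) where
  inv a := Classical.choose (exists_left_inv A a)
  inv_mul_cancel a := Classical.choose_spec (exists_left_inv A a)

end EquivariantAut

end Autoequivalences

end Equivariant

section Stable

variable {C : Type u} [Category.{v} C] [Preadditive C] [HasFiniteBiproducts C]

attribute [local instance] hasBinaryBiproducts_of_finite_biproducts

/-- `add T`: the direct summands of finite direct sums of copies of `T`. -/
def addClosure (T : C) : ObjectProperty C :=
  fun X => ∃ n : ℕ, Nonempty (Retract X (⨁ fun _ : Fin n => T))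

/-- `M` is basic: it is a finite direct sum of pairwise non-isomorphic indecomposable objects
(that is, in its decomposition each indecomposable summand has multiplicity one). -/
def IsBasic (M : C) : Prop :=
  ∃ (n : ℕ) (N : Fin n → C), Nonempty (M ≅ ⨁ N) ∧ (∀ i, Indecomposable (N i)) ∧
    ∀ i j, Nonempty (N i ≅ N j) → i = j

theorem indecomposable_map (F : C ⥤ C) [F.Additive] [F.IsEquivalence] {N : C}
    (h : Indecomposable N) : Indecomposable (F.obj N) := by
  have hz : ∀ {Y : C}, IsZero (F.inv.obj Y) → IsZero Y := fun {Y} hY =>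
    (F.map_isZero hY).of_iso (F.asEquivalence.counitIso.symm.app Y)
  have : F.inv.Additive := inv_additive F
  refine ⟨fun h0 => h.1 ((F.inv.map_isZero h0).of_iso (F.asEquivalence.unitIso.app N)),
    fun Y Z e => ?_⟩
  have : PreservesBinaryBiproducts F.inv :=
    preservesBinaryBiproducts_of_preservesBiproducts F.inv
  refine (h.2 (F.inv.obj Y) (F.inv.obj Z) (F.asEquivalence.unitIso.app N ≪≫ F.inv.mapIso e ≪≫
    F.inv.mapBiprod Y Z)).imp hz hz

theorem isBasic_map (F : C ⥤ C) [F.Additive] [F.IsEquivalence] {M : C} (h : IsBasic M) :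
    IsBasic (F.obj M) := by
  obtain ⟨n, N, ⟨e⟩, hN, hij⟩ := h
  exact ⟨n, fun i => F.obj (N i), ⟨F.mapIso e ≪≫ mapSumIso F N⟩, fun i => indecomposable_map F (hN i),
    fun i j ⟨f⟩ => hij i j ⟨F.preimageIso f⟩⟩

variable {k : Type w} [Field k] {G : Type w'} [Group G] [Linear k C] (A : LinearAction k G C)

/-- `M` is `G`-stable: `F_g M ≅ M` for all `g`. -/
def IsStable (M : C) : Prop := ∀ g, Nonempty ((A.F g).obj M ≅ M)

/-- The basic `G`-stable objects. -/
def BasicStable := {M : C // IsBasic M ∧ IsStable A M}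

instance BasicStable.setoid : Setoid (BasicStable A) :=
  (isIsomorphicSetoid C).comap Subtype.val

/-- `Stab^G(C)`: the set of isomorphism classes of basic `G`-stable objects. -/
def Stab := Quotient (BasicStable.setoid A)

variable {A}

/-- The image `F(M)` of a basic `G`-stable object under an equivariant autoequivalence. -/
def BasicStable.map (P : EquivariantAutoequiv A) (M : BasicStable A) : BasicStable A :=
  ⟨P.F.obj M.1, isBasic_map P.F M.2.1, fun g => by
    obtain ⟨e⟩ := M.2.2 g
    exact ⟨(P.δ g M.1).symm ≪≫ P.F.mapIso e⟩⟩

/-- The action of `Aut(C; G)` on `Stab^G(C)`, `[F, δ] • [M] = [F(M)]`. -/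
instance : MulAction (EquivariantAut A) (Stab A) where
  smul := Quotient.map₂ BasicStable.map (by
    rintro P Q ⟨φ, -⟩ M N ⟨e⟩
    exact ⟨P.F.mapIso e ≪≫ φ.app N.1⟩)
  one_smul := by
    rintro ⟨M⟩
    exact Quotient.sound ⟨Iso.refl M.1⟩
  mul_smul := by
    rintro ⟨P⟩ ⟨Q⟩ ⟨M⟩
    exact Quotient.sound ⟨Iso.refl _⟩

end Stable

/-- A finite group `G` splits over `k` if `kG` is isomorphic, as a `k`-algebra, to a finite
product of copies of `k`. -/
def SplitsOver (k : Type w) [Field k] (G : Type w') [Group G] : Prop :=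
  ∃ n : ℕ, Nonempty (MonoidAlgebra k G ≃ₐ[k] (Fin n → k))

end Equivariantization

end

/-! Objects are compared through the additive subcategory they generate. In a Hom-finite idempotent
complete category, Krull–Schmidt says that every object generates the same subcategory as some basic
object (`exists_isBasic`) and that this subcategory determines the basic object up to isomorphism
(`nonempty_iso_of_addClosure_eq`). The category of equivariant objects inherits both finiteness
conditions, so $\iota(M)$ can be defined as the basic object generating
$\mathrm{add}\,\mathrm{Ind}(M)$. It is $\widehat G$-stable because the scalars $\chi(h)$ on $F_h(M)$
give $\mathrm{Ind}(M)\simeq F_\chi\mathrm{Ind}(M)$. It is injective because forgetting the structure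
of $\mathrm{Ind}(M)$ leaves $\bigoplus_h F_h(M)$, which generates $\mathrm{add}\,M$ when $M$ is
stable.

The rest is duality: `comparison` sends $X$ to $\mathrm{Ind}(X)$ with these scalars and is an
equivalence $\mathcal C\simeq(\mathcal C^G)^{\widehat G}$. It is full because characters separate
the elements of $G$, which makes compatible maps diagonal. It is essentially surjective because
$|\widehat G|=|G|\neq0$ in $k$: averaging over $\widehat G$ cuts out a summand $Y$ with
$P\simeq\mathrm{Ind}(Y)$. For a stable $N$, applying this to the object induced from $N$ along
$\widehat G$ gives $Y$ with $\mathrm{Ind}(Y)\simeq\bigoplus_\chi F_\chi(N)$, hence surjectivity of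
$\iota$.

For the orbits, an equivariant autoequivalence $F$ of $\mathcal C$ lifts to $\mathcal C^G$ and
commutes with $\mathrm{Ind}$ (`indLiftIso`). Conversely, an autoequivalence $E$ of $\mathcal C^G$
lifts to $(\mathcal C^G)^{\widehat G}$. Since `comparison` is itself $G$-equivariant, conjugating by
it yields an equivariant autoequivalence $P$ of $\mathcal C$ with $\mathrm{Ind}\,P\simeq
E\,\mathrm{Ind}$ (`exists_autoequiv_of_dual`). -/

noncomputable section

namespace Equivariantization

/-! ### Krull–Schmidt theory in terms of additive closures. -/

section KrullSchmidt

attribute [local instance] hasBinaryBiproducts_of_finite_biproducts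

/-- In a finite-dimensional algebra whose only idempotents are `0` and `1`, every element `a` is a
unit or `1 - a` is. -/
theorem isUnit_or_isUnit_one_sub {k R : Type*} [Field k] [Ring R] [Algebra k R]
    [Module.Finite k R] (h : ∀ e : R, e * e = e → e = 0 ∨ e = 1) (a : R) :
    IsUnit a ∨ IsUnit (1 - a) := by
  have ha : IsIntegral k a := Algebra.IsIntegral.isIntegral a
  obtain ⟨q, hq, hnd⟩ :=
    (minpoly k a).exists_eq_pow_rootMultiplicity_mul_and_not_dvd (minpoly.ne_zero ha) 0
  set m := (minpoly k a).rootMultiplicity 0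
  rw [map_zero, sub_zero] at hq hnd
  -- Fitting's argument: the minimal polynomial is $X^m q$ with $q(0)\neq0$, and a Bézout relation
  -- $rX^{m+1}+sq=1$ makes $r(a)a^{m+1}$ idempotent. The exponent $m+1$ leaves a factor $a$ to split
  -- off even when $m=0$: value $1$ then inverts $a$, and value $0$ makes $a$ nilpotent.
  have hco : IsCoprime (Polynomial.X ^ (m + 1)) q :=
    ((Polynomial.irreducible_X.coprime_iff_not_dvd).2 hnd).pow_left
  obtain ⟨r, s, hrs⟩ := hco
  have h0 : a ^ m * Polynomial.aeval a q = 0 := by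
    simpa using (congrArg (Polynomial.aeval a) hq).symm.trans (minpoly.aeval k a)
  have h1 : Polynomial.aeval a r * a ^ (m + 1) + Polynomial.aeval a s * Polynomial.aeval a q = 1 := by
    simpa using congrArg (Polynomial.aeval a) hrs
  have hc : ∀ p₁ p₂ : Polynomial k, Polynomial.aeval a p₁ * Polynomial.aeval a p₂ =
      Polynomial.aeval a p₂ * Polynomial.aeval a p₁ := fun p₁ p₂ => by
    rw [← map_mul, mul_comm, map_mul]
  have hcr : Polynomial.aeval a r * a = a * Polynomial.aeval a r := by
    simpa using hc r Polynomial.X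
  have hcs : Polynomial.aeval a s * Polynomial.aeval a q * a ^ m = 0 := by
    have := hc q (Polynomial.X ^ m)
    simp only [map_pow, Polynomial.aeval_X] at this
    rw [mul_assoc, this, h0, mul_zero]
  have hpow : Polynomial.aeval a r * a ^ (m + 1) * a ^ (m + 1) = a ^ (m + 1) := by
    have := congrArg (fun x => x * a ^ (m + 1)) h1
    simp only [add_mul, one_mul] at this
    have h3 : Polynomial.aeval a s * Polynomial.aeval a q * a ^ (m + 1) = 0 := by
      rw [pow_succ, ← mul_assoc, hcs, zero_mul]
    rwa [h3, add_zero] at this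
  rcases h (Polynomial.aeval a r * a ^ (m + 1)) (by
    have := hc r (Polynomial.X ^ (m + 1))
    simp only [map_pow, Polynomial.aeval_X] at this
    nth_rw 2 [this]
    rw [← mul_assoc, hpow, this]) with h2 | h2
  · right
    have hn : IsNilpotent a := ⟨m + 1, by rw [← hpow, h2, zero_mul]⟩
    exact hn.isUnit_one_sub
  · left
    refine isUnit_iff_exists.2 ⟨Polynomial.aeval a r * a ^ m, ?_, ?_⟩
    · rw [← mul_assoc, ← hcr, mul_assoc, ← pow_succ', h2]
    · rw [mul_assoc, ← pow_succ, h2]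

variable {C : Type u} [Category.{v} C] [Preadditive C]

theorem exists_isUnit_of_isUnit_sum {R J : Type*} [Ring R] [IsLocalRing R] (s : Finset J)
    (a : J → R) (h : IsUnit (∑ j ∈ s, a j)) : ∃ j ∈ s, IsUnit (a j) := by
  classical
  have key : ∀ x y : R, IsUnit (x + y) → IsUnit x ∨ IsUnit y := by
    rintro x y ⟨c, hc⟩
    have : (↑c⁻¹ : R) * x + ↑c⁻¹ * y = 1 := by rw [← mul_add, ← hc, Units.inv_mul]
    exact (IsLocalRing.isUnit_or_isUnit_of_add_one this).imp (by simp) (by simp)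
  induction s using Finset.induction_on with
  | empty => simp at h
  | insert j s hj ih =>
    rw [Finset.sum_insert hj] at h
    rcases key _ _ h with h | h
    · exact ⟨j, by simp, h⟩
    · obtain ⟨i, hi, h⟩ := ih h
      exact ⟨i, by simp [hi], h⟩

/-- If the identity of an object with local endomorphism ring is a sum of maps factoring through
the `T j`, then the object is a retract of some `T j`. -/
theorem exists_retract_of_sum {N : C} [IsLocalRing (End N)] {J : Type*} [Fintype J] {T : J → C}
    (a : ∀ j, N ⟶ T j) (b : ∀ j, T j ⟶ N) (h : ∑ j, a j ≫ b j = 𝟙 N) :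
    ∃ j, Nonempty (Retract N (T j)) := by
  obtain ⟨j, -, hj⟩ := exists_isUnit_of_isUnit_sum (R := End N) Finset.univ
    (fun j => a j ≫ b j) (by rw [h]; exact isUnit_one)
  obtain ⟨c, hc⟩ := hj.exists_left_inv
  exact ⟨j, ⟨a j, b j ≫ c, by simpa [End.mul_def] using hc⟩⟩

theorem sum_comp_comp {J : Type*} [Fintype J] {X Y Z : C} {T : J → C} {a : ∀ j, X ⟶ T j}
    {b : ∀ j, T j ⟶ X} (h : ∑ j, a j ≫ b j = 𝟙 X) (f : Y ⟶ X) (g : X ⟶ Z) :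
    ∑ j, (f ≫ a j) ≫ b j ≫ g = f ≫ g := by
  have : f ≫ (∑ j, a j ≫ b j) ≫ g = f ≫ g := by rw [h, Category.id_comp]
  simpa [Preadditive.sum_comp, Preadditive.comp_sum] using this

variable [HasFiniteBiproducts C]

/-- Idempotent endomorphisms of an indecomposable object are trivial. -/
theorem indecomposable_idem [IsIdempotentComplete C] {N : C} (h : Indecomposable N)
    {e : N ⟶ N} (he : e ≫ e = e) : e = 0 ∨ e = 𝟙 N := by
  -- Splitting both $e$ and $1-e$ decomposes $N$ as a biproduct, so indecomposability kills one of
  -- the two images.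
  obtain ⟨Y, i, r, hi, hr⟩ := IsIdempotentComplete.idempotents_split N e he
  obtain ⟨Z, i', r', hi', hr'⟩ := IsIdempotentComplete.idempotents_split N (𝟙 N - e) (by
    simp [he])
  have h1 : i ≫ r' = 0 := by
    have : (r ≫ i) ≫ (r' ≫ i') = 0 := by rw [hr, hr']; simp [he]
    have := congrArg (fun x => i ≫ x ≫ r') this
    simpa [reassoc_of% hi, hi'] using this
  have h2 : i' ≫ r = 0 := by
    have : (r' ≫ i') ≫ (r ≫ i) = 0 := by rw [hr, hr']; simp [he]
    have := congrArg (fun x => i' ≫ x ≫ r) this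
    simpa [reassoc_of% hi', hi] using this
  have E : N ≅ Y ⊞ Z :=
    { hom := biprod.lift r r'
      inv := biprod.desc i i'
      hom_inv_id := by rw [biprod.lift_desc, hr, hr']; simp
      inv_hom_id := by
        ext <;> simp [hi, hi', h1, h2] }
  rcases h.2 Y Z E with hY | hZ
  · left
    rw [← hr, hY.eq_of_tgt r 0, zero_comp]
  · right
    have : 𝟙 N - e = 0 := by rw [← hr', hZ.eq_of_tgt r' 0, zero_comp]
    exact (sub_eq_zero.1 this).symm

theorem isLocalRing_end [IsIdempotentComplete C] (k : Type*) [Field k] [Linear k C]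
    {N : C} [Module.Finite k (N ⟶ N)] (h : Indecomposable N) : IsLocalRing (End N) := by
  have : Nontrivial (End N) := ⟨1, 0, fun h0 => h.1 ((IsZero.iff_id_eq_zero N).2 h0)⟩
  have : Module.Finite k (End N) := ‹Module.Finite k (N ⟶ N)›
  exact .of_isUnit_or_isUnit_one_sub_self
    (isUnit_or_isUnit_one_sub (k := k) fun e he => indecomposable_idem h he)

theorem addClosure_of_sum {T X : C} {J : Type*} [Fintype J] (a : J → (X ⟶ T)) (b : J → (T ⟶ X))
    (h : ∑ j, a j ≫ b j = 𝟙 X) : addClosure T X := by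
  let e := (Fintype.equivFin J).symm
  refine ⟨Fintype.card J, ⟨biproduct.lift fun j => a (e j), biproduct.desc fun j => b (e j), ?_⟩⟩
  rw [lift_desc', ← h]
  exact Fintype.sum_equiv e _ _ fun _ => rfl

/-- Membership in $\mathrm{add}\,T$ becomes a statement about morphisms only. In this form it
composes, and additive functors preserve it, without handling biproducts. -/
theorem addClosure_iff {T X : C} : addClosure T X ↔
    ∃ (n : ℕ) (a : Fin n → (X ⟶ T)) (b : Fin n → (T ⟶ X)), ∑ j, a j ≫ b j = 𝟙 X := by
  refine ⟨fun ⟨n, ⟨r⟩⟩ => ⟨n, fun j => r.i ≫ biproduct.π _ j, fun j => biproduct.ι (fun _ : Fin n => T) j ≫ r.r, ?_⟩,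
    fun ⟨n, a, b, h⟩ => addClosure_of_sum a b h⟩
  have := sum_comp_comp (total' (fun _ : Fin n => T)) r.i r.r
  rwa [r.retract] at this

theorem addClosure_of_retract {T X : C} (r : Retract X T) : addClosure T X :=
  addClosure_of_sum (J := Unit) (fun _ => r.i) (fun _ => r.r) (by simp)

theorem addClosure_self (T : C) : addClosure T T := addClosure_of_retract (Retract.refl T)

theorem addClosure_of_iso {T X : C} (e : X ≅ T) : addClosure T X :=
  addClosure_of_retract (Retract.ofIso e)

theorem addClosure_trans {T T' X : C} (h : addClosure T X) (h' : addClosure T' T) :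
    addClosure T' X := by
  obtain ⟨n, a, b, hab⟩ := addClosure_iff.1 h
  obtain ⟨m, c, d, hcd⟩ := addClosure_iff.1 h'
  refine addClosure_of_sum (J := Fin n × Fin m) (fun p => a p.1 ≫ c p.2) (fun p => d p.2 ≫ b p.1) ?_
  rw [Fintype.sum_prod_type, ← hab]
  refine Finset.sum_congr rfl fun i _ => ?_
  exact sum_comp_comp hcd (a i) (b i)

theorem addClosure_eq {T T' : C} (h : addClosure T' T) (h' : addClosure T T') :
    addClosure T = addClosure T' :=
  funext fun _ => propext ⟨fun hX => addClosure_trans hX h, fun hX => addClosure_trans hX h'⟩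

theorem addClosure_eq_of_iso {T T' : C} (e : T ≅ T') : addClosure T = addClosure T' :=
  addClosure_eq (addClosure_of_iso e) (addClosure_of_iso e.symm)

theorem addClosure_biproduct {T : C} {J : Type*} [Finite J] (f : J → C)
    (h : ∀ j, addClosure T (f j)) : addClosure T (⨁ f) := by
  cases nonempty_fintype J
  choose n a b hab using fun j => addClosure_iff.1 (h j)
  refine addClosure_of_sum (J := Σ j, Fin (n j)) (fun p => biproduct.π f p.1 ≫ a p.1 p.2)
    (fun p => b p.1 p.2 ≫ biproduct.ι f p.1) ?_
  rw [Fintype.sum_sigma, ← total']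
  refine Finset.sum_congr rfl fun j _ => ?_
  exact sum_comp_comp (hab j) (biproduct.π f j) (biproduct.ι f j)

theorem addClosure_component {J : Type*} [Finite J] (f : J → C) (j : J) :
    addClosure (⨁ f) (f j) :=
  addClosure_of_retract ⟨biproduct.ι f j, biproduct.π f j, by simp⟩

theorem addClosure_map {D : Type*} [Category* D] [Preadditive D] [HasFiniteBiproducts D]
    (F : C ⥤ D) [F.Additive] {T X : C} (h : addClosure T X) :
    addClosure (F.obj T) (F.obj X) := by
  obtain ⟨n, a, b, hab⟩ := addClosure_iff.1 h
  refine addClosure_of_sum (fun j => F.map (a j)) (fun j => F.map (b j)) ?_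
  simp only [← F.map_comp]
  rw [← F.map_sum, hab, F.map_id]

theorem addClosure_map_eq {D : Type*} [Category* D] [Preadditive D] [HasFiniteBiproducts D]
    (F : C ⥤ D) [F.Additive] {T T' : C} (h : addClosure T = addClosure T') :
    addClosure (F.obj T) = addClosure (F.obj T') :=
  addClosure_eq (addClosure_map F (h ▸ addClosure_self T))
    (addClosure_map F (h ▸ addClosure_self T'))

/-- The retraction gives an idempotent of $N'$. It is not $0$, as $N\neq0$, so it is the identity
and the retraction is invertible. -/
theorem nonempty_iso_of_retract [IsIdempotentComplete C] {N N' : C} (h : Indecomposable N)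
    (h' : Indecomposable N') (r : Retract N N') : Nonempty (N ≅ N') := by
  rcases indecomposable_idem h' (e := r.r ≫ r.i) (by simp) with h0 | h1
  · refine absurd ((IsZero.iff_id_eq_zero N).2 ?_) h.1
    have := congrArg (fun x => r.i ≫ x ≫ r.r) h0
    simpa using this
  · exact ⟨⟨r.i, r.r, r.retract, h1⟩⟩

variable {k : Type w} [Field k] [Linear k C]

/-- The descent measure for decomposing objects. Extension by zero embeds $\mathrm{End}(Y)$ in
$\mathrm{End}(X)$, and $1_X$ is missed because it does not vanish on $Z$. -/
theorem finrank_end_lt {X Y Z : C} [Module.Finite k (X ⟶ X)] (e : X ≅ Y ⊞ Z) (hZ : ¬IsZero Z) :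
    Module.finrank k (Y ⟶ Y) < Module.finrank k (X ⟶ X) := by
  let i : Y ⟶ X := biprod.inl ≫ e.inv
  let r : X ⟶ Y := e.hom ≫ biprod.fst
  have hir : i ≫ r = 𝟙 Y := by simp [i, r]
  let φ : (Y ⟶ Y) →ₗ[k] (X ⟶ X) :=
    { toFun := fun f => r ≫ f ≫ i
      map_add' := by simp
      map_smul' := by simp }
  have hφ : Function.Injective φ := fun f g hfg => by
    have : r ≫ f ≫ i = r ≫ g ≫ i := hfg
    have := congrArg (fun x => i ≫ x ≫ r) this
    simpa [reassoc_of% hir, hir] using this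
  rw [← LinearMap.finrank_range_of_inj hφ]
  refine Submodule.finrank_lt fun htop => hZ ((IsZero.iff_id_eq_zero Z).2 ?_)
  obtain ⟨f, hf⟩ : 𝟙 X ∈ LinearMap.range φ := htop ▸ Submodule.mem_top
  have hf : r ≫ f ≫ i = 𝟙 X := hf
  have := congrArg (fun x => biprod.inr ≫ e.inv ≫ x ≫ e.hom ≫ biprod.snd) hf
  simpa [r, i] using this.symm

/-- Every object generates the same subcategory as a finite direct sum of indecomposables. -/
theorem exists_indecomposables (homFinite : ∀ X Y : C, Module.Finite k (X ⟶ Y)) (X : C) :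
    ∃ (J : Type) (_ : Finite J) (N : J → C), (∀ j, Indecomposable (N j)) ∧
      addClosure (⨁ N) X ∧ ∀ j, addClosure X (N j) := by
  induction hn : Module.finrank k (X ⟶ X) using Nat.strong_induction_on generalizing X with
  | _ n ih =>
    subst hn
    by_cases h0 : IsZero X
    · exact ⟨Empty, inferInstance, Empty.elim, fun j => j.elim,
        addClosure_of_sum (J := Empty) (fun j => j.elim) (fun j => j.elim) (h0.eq_of_src _ _),
        fun j => j.elim⟩
    by_cases hX : Indecomposable X
    · exact ⟨Unit, inferInstance, fun _ => X, fun _ => hX, addClosure_component _ (),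
        fun _ => addClosure_self X⟩
    have : ∃ Y Z, ∃ _ : X ≅ Y ⊞ Z, ¬IsZero Y ∧ ¬IsZero Z := by
      by_contra! hc
      exact hX ⟨h0, fun Y Z e => or_iff_not_imp_left.2 (hc Y Z e)⟩
    obtain ⟨Y, Z, e, hY, hZ⟩ := this
    have := homFinite X X
    obtain ⟨J, _, N, hN, hYN, hNY⟩ := ih _ (finrank_end_lt (k := k) e hZ) Y rfl
    obtain ⟨J', _, N', hN', hZN, hNZ⟩ :=
      ih _ (finrank_end_lt (k := k) (e ≪≫ biprod.braiding Y Z) hY) Z rfl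
    have hl : ∀ j, addClosure (⨁ Sum.elim N N') (N j) := fun j =>
      addClosure_component (Sum.elim N N') (Sum.inl j)
    have hr : ∀ j, addClosure (⨁ Sum.elim N N') (N' j) := fun j =>
      addClosure_component (Sum.elim N N') (Sum.inr j)
    have hY' := addClosure_trans hYN (addClosure_biproduct N hl)
    have hZ' := addClosure_trans hZN (addClosure_biproduct N' hr)
    refine ⟨J ⊕ J', inferInstance, Sum.elim N N', by rintro (j | j) <;> simp [hN, hN'], ?_, ?_⟩
    · obtain ⟨n, a, b, hab⟩ := addClosure_iff.1 hY'
      obtain ⟨m, c, d, hcd⟩ := addClosure_iff.1 hZ'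
      refine addClosure_of_sum (J := Fin n ⊕ Fin m)
        (Sum.elim (fun j => e.hom ≫ biprod.fst ≫ a j) (fun j => e.hom ≫ biprod.snd ≫ c j))
        (Sum.elim (fun j => b j ≫ biprod.inl ≫ e.inv) (fun j => d j ≫ biprod.inr ≫ e.inv)) ?_
      simp only [Fintype.sum_sum_type, Sum.elim_inl, Sum.elim_inr]
      have h1 := sum_comp_comp hab (e.hom ≫ biprod.fst) (biprod.inl ≫ e.inv)
      have h2 := sum_comp_comp hcd (e.hom ≫ biprod.snd) (biprod.inr ≫ e.inv)
      simp only [Category.assoc] at h1 h2 ⊢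
      rw [h1, h2, ← Category.assoc biprod.fst, ← Category.assoc biprod.snd, ← Preadditive.comp_add,
        ← Preadditive.add_comp, biprod.total]
      simp
    · rintro (j | j)
      · exact addClosure_trans (hNY j)
          (addClosure_of_retract ⟨biprod.inl ≫ e.inv, e.hom ≫ biprod.fst, by simp⟩)
      · exact addClosure_trans (hNZ j)
          (addClosure_of_retract ⟨biprod.inr ≫ e.inv, e.hom ≫ biprod.snd, by simp⟩)

/-- Every object generates the same subcategory as some basic object. -/
theorem exists_isBasic (homFinite : ∀ X Y : C, Module.Finite k (X ⟶ Y)) (X : C) :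
    ∃ M : C, IsBasic M ∧ addClosure M = addClosure X := by
  obtain ⟨J, _, N, hN, hXN, hNX⟩ := exists_indecomposables homFinite X
  -- One summand is kept from each isomorphism class; multiplicities do not affect the additive
  -- closure.
  let S : Setoid J := (isIsomorphicSetoid C).comap N
  let σ := (Finite.equivFin (Quotient S)).symm
  refine ⟨⨁ fun i => N (σ i).out, ⟨_, _, ⟨Iso.refl _⟩, fun i => hN _, fun i j hij => ?_⟩,
    addClosure_eq (addClosure_biproduct _ fun i => hNX _)
      (addClosure_trans hXN (addClosure_biproduct N fun j => ?_))⟩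
  · exact σ.injective (Quotient.out_equiv_out.1 hij)
  · have h1 := addClosure_component (fun i => N (σ i).out) (σ.symm (Quotient.mk S j))
    obtain ⟨e⟩ : IsIsomorphic (N (Quotient.mk S j).out) (N j) := Quotient.mk_out (s := S) j
    rw [Equiv.apply_symm_apply] at h1
    exact addClosure_trans (addClosure_of_iso e.symm) h1

variable [IsIdempotentComplete C]

/-- An indecomposable object of `add (⨁ N)` is isomorphic to some `N j`. -/
theorem exists_iso_of_addClosure (homFinite : ∀ X Y : C, Module.Finite k (X ⟶ Y)) {X : C}
    (hX : Indecomposable X) {J : Type*} [Finite J] {N : J → C} (hN : ∀ j, Indecomposable (N j))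
    (h : addClosure (⨁ N) X) : ∃ j, Nonempty (X ≅ N j) := by
  cases nonempty_fintype J
  have := homFinite X X
  have := isLocalRing_end k hX
  obtain ⟨n, a, b, hab⟩ := addClosure_iff.1 h
  obtain ⟨-, ⟨r⟩⟩ := exists_retract_of_sum a b hab
  obtain ⟨j, ⟨s⟩⟩ := exists_retract_of_sum (T := N) (fun j => r.i ≫ biproduct.π N j)
    (fun j => biproduct.ι N j ≫ r.r) (by
      have := sum_comp_comp (total' N) r.i r.r
      rwa [r.retract] at this)
  exact ⟨j, nonempty_iso_of_retract hX (hN j) s⟩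

/-- Basic objects are determined by the subcategory they generate. -/
theorem nonempty_iso_of_addClosure_eq (homFinite : ∀ X Y : C, Module.Finite k (X ⟶ Y)) {M M' : C}
    (hM : IsBasic M) (hM' : IsBasic M') (h : addClosure M = addClosure M') :
    Nonempty (M ≅ M') := by
  obtain ⟨n, N, ⟨e⟩, hN, hi⟩ := hM
  obtain ⟨n', N', ⟨e'⟩, hN', hi'⟩ := hM'
  rw [addClosure_eq_of_iso e, addClosure_eq_of_iso e'] at h
  choose s hs using fun i => exists_iso_of_addClosure homFinite (hN i) hN'
    (h ▸ addClosure_component N i)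
  choose t ht using fun i => exists_iso_of_addClosure homFinite (hN' i) hN
    (h ▸ addClosure_component N' i)
  -- Pairwise non-isomorphism on each side forces the two matchings of summands to be mutually
  -- inverse.
  let σ : Fin n ≃ Fin n' :=
    { toFun := s
      invFun := t
      left_inv := fun i => (hi _ _ ⟨(hs i).some ≪≫ (ht _).some⟩).symm
      right_inv := fun i => (hi' _ _ ⟨(ht i).some ≪≫ (hs _).some⟩).symm }
  exact ⟨e ≪≫ biproduct.whiskerEquiv σ (fun i => (hs i).some.symm) ≪≫ e'.symm⟩

end KrullSchmidt

/-! ### Characters of a group that splits over the field. -/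

section Characters

variable {k : Type w} [Field k] {G : Type w'}

/-- Dedekind: distinct characters are linearly independent in the finite-dimensional space of
functions on $G$. -/
instance finite_characters [Group G] [Finite G] : Finite (G →* kˣ) := by
  cases nonempty_fintype G
  have : Finite (G →* k) := (linearIndependent_monoidHom G k).finite
  exact Finite.of_injective (fun χ : G →* kˣ => (Units.coeHom k).comp χ) fun χ ψ h => by
    ext g
    exact DFunLike.congr_fun h g

/-- The norm element $s=\sum_g g$ satisfies $s^2=|G|s$. If $|G|$ vanished in $k$, then $s^2=0$ and
hence $s=0$, since a product of fields is reduced; but the coefficient of $s$ at $1$ is $1$. -/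
theorem card_ne_zero [Group G] [Finite G] (hG : SplitsOver k G) : (Nat.card G : k) ≠ 0 := by
  classical
  cases nonempty_fintype G
  obtain ⟨n, ⟨φ⟩⟩ := hG
  intro h0
  let s : MonoidAlgebra k G := ∑ g, MonoidAlgebra.of k G g
  have hs : ∀ g, MonoidAlgebra.of k G g * s = s := fun g => by
    simp only [s, Finset.mul_sum, ← map_mul]
    exact Fintype.sum_equiv (Equiv.mulLeft g) _ (fun h => MonoidAlgebra.of k G h) fun _ => rfl
  have hss : s * s = 0 := by
    calc s * s = ∑ g, MonoidAlgebra.of k G g * s := Finset.sum_mul _ _ _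
      _ = ∑ _g : G, s := Finset.sum_congr rfl fun g _ => hs g
      _ = (Nat.card G : k) • s := by
        rw [Finset.sum_const, Finset.card_univ, Nat.card_eq_fintype_card, Nat.cast_smul_eq_nsmul]
      _ = 0 := by rw [h0, zero_smul]
  have h1 : φ s = 0 := by
    have := congrArg φ hss
    rw [map_mul, map_zero] at this
    funext i
    exact mul_self_eq_zero.1 (congrFun this i)
  have h2 : s = 0 := φ.injective (h1.trans (map_zero φ).symm)
  have h3 := congrArg (fun x : MonoidAlgebra k G => x.coeff 1) h2
  simp [s, MonoidAlgebra.of, Finsupp.finsetSum_apply, Finsupp.single_apply] at h3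

/-- If `G` splits over `k`, then characters separate the elements of `G`. -/
theorem exists_character_ne [Group G] (hG : SplitsOver k G) {g h : G} (hgh : g ≠ h) :
    ∃ χ : G →* kˣ, χ g ≠ χ h := by
  obtain ⟨n, ⟨φ⟩⟩ := hG
  by_contra! hc
  refine hgh (MonoidAlgebra.of_injective (R := k) (φ.injective ?_))
  funext i
  -- Each coordinate of the splitting restricts to a character of $G$, with values in units because
  -- $G$ is a group. Elements not separated by characters would thus coincide in $kG$.
  let ψ : G →* k := ((Pi.evalMonoidHom (fun _ : Fin n => k) i).comp
    (φ : MonoidAlgebra k G →* (Fin n → k))).comp (MonoidAlgebra.of k G)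
  exact congrArg Units.val (hc ψ.toHomUnits)

theorem sum_character_eq_zero [Group G] [Fintype G] {χ : G →* kˣ} (hχ : χ ≠ 1) :
    ∑ g, (χ g : k) = 0 := by
  obtain ⟨h, hh⟩ : ∃ h, χ h ≠ 1 := by
    by_contra! hc
    exact hχ (MonoidHom.ext hc)
  have : (χ h : k) * ∑ g, (χ g : k) = ∑ g, (χ g : k) := by
    rw [Finset.mul_sum]
    exact Fintype.sum_equiv (Equiv.mulLeft h) _ (fun g => (χ g : k)) fun g => by simp
  have h0 : ((χ h : k) - 1) * ∑ g, (χ g : k) = 0 := by rw [sub_mul, this, one_mul, sub_self]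
  refine (mul_eq_zero.1 h0).resolve_left fun h1 => hh (Units.ext ?_)
  rw [Units.val_one]
  exact sub_eq_zero.1 h1

/-- Orthogonality applied to the group $\widehat G$ and its character "evaluation at $g$", which is
nontrivial because characters separate points. -/
theorem sum_characters_apply_eq_zero [Group G] (hG : SplitsOver k G) [Fintype (G →* kˣ)] {g : G}
    (hg : g ≠ 1) : ∑ χ : G →* kˣ, (χ g : k) = 0 := by
  obtain ⟨ψ, hψ⟩ := exists_character_ne hG hg
  refine sum_character_eq_zero (χ := (MonoidHom.eval g : (G →* kˣ) →* kˣ)) fun h => hψ ?_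
  rw [map_one]
  exact DFunLike.congr_fun h ψ

/-- Both sides compute $\sum_{\chi,g}\chi(g)$: summing over $g$ first leaves only $\chi=1$, summing
over $\chi$ first leaves only $g=1$. The equality in $k$ is all that averaging needs. -/
theorem card_characters [Group G] [Finite G] (hG : SplitsOver k G) :
    (Nat.card (G →* kˣ) : k) = Nat.card G := by
  classical
  cases nonempty_fintype G
  cases nonempty_fintype (G →* kˣ)
  have h1 : ∑ χ : G →* kˣ, ∑ g, (χ g : k) = Nat.card G := by
    rw [Finset.sum_eq_single 1]
    · simp
    · intro χ _ hχ
      exact sum_character_eq_zero hχ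
    · simp
  have h2 : ∑ χ : G →* kˣ, ∑ g, (χ g : k) = Nat.card (G →* kˣ) := by
    rw [Finset.sum_comm, Finset.sum_eq_single 1]
    · simp
    · intro g _ hg
      exact sum_characters_apply_eq_zero hG hg
    · simp
  rw [← h1, h2]

end Characters

/-! ### Hom-finiteness and idempotent completeness pass to equivariant objects. -/

section EquivariantCategory

variable {k : Type w} [Field k] {G : Type w'} [Group G]
  {C : Type u} [Category.{v} C] [Preadditive C] [Linear k C]

theorem homFinite_equivariant (homFinite : ∀ X Y : C, Module.Finite k (X ⟶ Y))
    (A : LinearAction k G C) (P Q : EquivariantObject A) : Module.Finite k (P ⟶ Q) := by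
  have := homFinite P.X Q.X
  let φ : (P ⟶ Q) →ₗ[k] (P.X ⟶ Q.X) :=
    { toFun := fun a => a.f
      map_add' := fun _ _ => rfl
      map_smul' := fun _ _ => rfl }
  exact Module.Finite.of_injective φ (EquivariantObject.f_injective P Q)

instance idempotentComplete_equivariant [IsIdempotentComplete C] (A : LinearAction k G C) :
    IsIdempotentComplete (EquivariantObject A) where
  idempotents_split P p hp := by
    have hp' : p.f ≫ p.f = p.f := congrArg EquivariantObject.Hom.f hp
    obtain ⟨Y, i, r, hir, hri⟩ := IsIdempotentComplete.idempotents_split P.X p.f hp'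
    have hip : i ≫ p.f = i := by rw [← hri, reassoc_of% hir]
    have hpr : p.f ≫ r = r := by rw [← hri, Category.assoc, hir, Category.comp_id]
    have hinv : ∀ g, (A.F g).map p.f ≫ (P.α g).inv = (P.α g).inv ≫ p.f := fun g => by
      rw [Iso.comp_inv_eq, Category.assoc, p.comm, Iso.inv_hom_id_assoc]
    -- The idempotent is split in $\mathcal C$, and its image carries the compressed structure
    -- $F_g(r)\circ\alpha_g\circ i$; this is invertible because the idempotent commutes with
    -- $\alpha$.
    let Q : EquivariantObject A :=
      { X := Y
        α := fun g =>
          { hom := i ≫ (P.α g).hom ≫ (A.F g).map r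
            inv := (A.F g).map i ≫ (P.α g).inv ≫ r
            hom_inv_id := by
              simp only [Category.assoc]
              rw [← Functor.map_comp_assoc, hri, reassoc_of% (hinv g), Iso.hom_inv_id_assoc,
                reassoc_of% hip, hir]
            inv_hom_id := by
              simp only [Category.assoc]
              rw [reassoc_of% hri, ← reassoc_of% (hinv g), Iso.inv_hom_id_assoc,
                ← Functor.map_comp, ← Functor.map_comp, hpr, hir, CategoryTheory.Functor.map_id] }
        α_mul := fun g h => by
          simp only [Functor.map_comp, Category.assoc]
          rw [A.ε_naturality, ← Functor.map_comp_assoc, hri, ← reassoc_of% (p.comm g),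
            reassoc_of% hip, P.α_mul]
          simp only [Category.assoc] }
    refine ⟨Q, ⟨i, fun g => ?_⟩, ⟨r, fun g => ?_⟩, ?_, ?_⟩
    · change i ≫ (P.α g).hom = (i ≫ (P.α g).hom ≫ (A.F g).map r) ≫ (A.F g).map i
      rw [Category.assoc, Category.assoc, ← Functor.map_comp, hri, ← p.comm, reassoc_of% hip]
    · change r ≫ i ≫ (P.α g).hom ≫ (A.F g).map r = (P.α g).hom ≫ (A.F g).map r
      rw [reassoc_of% hri, reassoc_of% (p.comm g), ← Functor.map_comp, hpr]
    · ext
      exact hir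
    · ext
      exact hri

end EquivariantCategory

/-! ### The equivalence between $\mathcal C$ and $(\mathcal C^G)^{\widehat G}$. -/

section Duality

variable {k : Type w} [Field k] {G : Type w'} [Group G]
  {C : Type u} [Category.{v} C] [Preadditive C] [Linear k C]

/-- The strict action of a group `K` on equivariant objects by twisting along a homomorphism from
`K` to the character group. -/
def twistAction {K : Type*} [Group K] (A : LinearAction k G C) (φ : K →* G →* kˣ) :
    LinearAction k K (EquivariantObject A) where
  F x := twist A (φ x)
  additive _ := inferInstance
  linear _ := inferInstance
  isEquivalence _ := inferInstance
  ε x y P := EquivariantObject.mkIso (Iso.refl P.X) (fun g => by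
    simp [twist, smul_smul])
  ε_naturality x y P Q a := by
    ext
    exact (Category.comp_id a.f).trans (Category.id_comp a.f).symm
  cocycle x y z P := by
    ext
    have : (eqToHom (congrArg (fun a => (twist A (φ a)).obj P) (mul_assoc x y z))).f = 𝟙 P.X :=
      eqToHom_f P (congrArg φ (mul_assoc x y z))
    rw [EquivariantObject.comp_f, EquivariantObject.comp_f, this]
    change 𝟙 P.X ≫ 𝟙 P.X ≫ 𝟙 P.X = 𝟙 P.X ≫ 𝟙 P.X
    simp

/-- The action of `G` on the bi-equivariant objects through evaluation of characters. -/
abbrev bidualAction (A : LinearAction k G C) :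
    LinearAction k G (EquivariantObject (dualAction A)) :=
  twistAction (dualAction A) MonoidHom.eval

/-- The condition `hb` says that $b$ is a morphism $P\to F_\chi P$; moving such a map past
$\alpha_g$ costs a power of $\chi(g)$. -/
theorem α_inv_comp {A : LinearAction k G C} (P : EquivariantObject A) {χ : G →* kˣ}
    {b : P.X ⟶ P.X} (hb : ∀ g, b ≫ ((χ g⁻¹ : k) • (P.α g).hom) = (P.α g).hom ≫ (A.F g).map b)
    (g : G) : (A.F g).map b ≫ (P.α g).inv = (χ g⁻¹ : k) • ((P.α g).inv ≫ b) := by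
  rw [Iso.comp_inv_eq, Linear.smul_comp, Category.assoc, ← Linear.comp_smul, ← Linear.comp_smul,
    hb, Iso.inv_hom_id_assoc]

theorem comp_α {A : LinearAction k G C} (P : EquivariantObject A) {χ : G →* kˣ}
    {b : P.X ⟶ P.X} (hb : ∀ g, b ≫ ((χ g⁻¹ : k) • (P.α g).hom) = (P.α g).hom ≫ (A.F g).map b)
    (g : G) : b ≫ (P.α g).hom = (χ g : k) • ((P.α g).hom ≫ (A.F g).map b) := by
  rw [← hb, Linear.comp_smul, smul_smul]
  simp

theorem cocycle_inv (A : LinearAction k G C) (g h l : G) (X : C) :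
    (A.ε (g * h) l X).inv ≫ (A.ε g h ((A.F l).obj X)).inv =
      eqToHom (congrArg (fun a => (A.F a).obj X) (mul_assoc g h l)) ≫
        (A.ε g (h * l) X).inv ≫ (A.F g).map (A.ε h l X).inv := by
  rw [← cancel_epi (A.ε (g * h) l X).hom, ← cancel_epi (A.ε g h ((A.F l).obj X)).hom,
    reassoc_of% A.cocycle g h l X]
  simp [← Functor.map_comp]

variable [HasFiniteBiproducts C] [Finite G]

/-- The diagonal endomorphism of a direct sum given by a family of scalars. -/
def diagScale {J : Type*} [Finite J] (f : J → C) (c : J → k) : (⨁ f) ⟶ (⨁ f) :=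
  biproduct.map fun j => c j • 𝟙 (f j)

@[simp]
theorem diagScale_π {J : Type*} [Finite J] (f : J → C) (c : J → k) (j : J) :
    diagScale f c ≫ biproduct.π f j = c j • biproduct.π f j := by
  simp [diagScale]

@[simp]
theorem ι_diagScale {J : Type*} [Finite J] (f : J → C) (c : J → k) (j : J) :
    biproduct.ι f j ≫ diagScale f c = c j • biproduct.ι f j := by
  simp [diagScale]

theorem diagScale_comp {J : Type*} [Finite J] (f : J → C) (c d : J → k) :
    diagScale f c ≫ diagScale f d = diagScale f (c * d) := by
  apply biproduct.hom_ext
  intro j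
  simp [smul_smul, mul_comm]

theorem diagScale_comp_eq_id {J : Type*} [Finite J] (f : J → C) (c d : J → k)
    (h : ∀ j, c j * d j = 1) : diagScale f c ≫ diagScale f d = 𝟙 (⨁ f) := by
  apply biproduct.hom_ext
  intro j
  simp [smul_smul, mul_comm (d j), h]

/-- The isomorphism `Ind X ≅ F_χ (Ind X)` given by the scalar `χ(h)` on `F_h X`. -/
def indTwistIso (A : LinearAction k G C) (X : C) (χ : G →* kˣ) :
    indObj A X ≅ (twist A χ).obj (indObj A X) :=
  EquivariantObject.mkIso (P := indObj A X) (Q := (twist A χ).obj (indObj A X))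
    { hom := diagScale (fun h => (A.F h).obj X) fun h => (χ h : k)
      inv := diagScale (fun h => (A.F h).obj X) fun h => (χ h⁻¹ : k)
      hom_inv_id := diagScale_comp_eq_id (fun h => (A.F h).obj X) _ _ fun h => by simp
      inv_hom_id := diagScale_comp_eq_id (fun h => (A.F h).obj X) _ _ fun h => by simp }
    (fun g => by
      apply hom_ext_map_sum
      intro l
      change (diagScale (fun h => (A.F h).obj X) (fun h => (χ h : k)) ≫
        ((χ g⁻¹ : k) • (indIso A X g).hom)) ≫ (A.F g).map (biproduct.π _ l) =
        ((indIso A X g).hom ≫ (A.F g).map (diagScale (fun h => (A.F h).obj X) (fun h => (χ h : k)))) ≫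
          (A.F g).map (biproduct.π _ l)
      simp only [Category.assoc, Linear.comp_smul, Linear.smul_comp, indIso_π,
        ← Functor.map_comp, diagScale_π, Functor.map_smul]
      rw [← Category.assoc, diagScale_π]
      simp [smul_smul])

/-- The comparison functor from `C` to the bi-equivariant objects. -/
def comparison (A : LinearAction k G C) : C ⥤ EquivariantObject (dualAction A) where
  obj X :=
    { X := indObj A X
      α := indTwistIso A X
      α_mul := fun χ ψ => by
        ext1
        change diagScale (fun h => (A.F h).obj X) (fun h => ((χ * ψ) h : k)) =
          diagScale (fun h => (A.F h).obj X) (fun h => (χ h : k)) ≫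
          diagScale (fun h => (A.F h).obj X) (fun h => (ψ h : k)) ≫ 𝟙 _
        rw [Category.comp_id, diagScale_comp]
        congr 1 }
  map {X Y} θ :=
    { f := (inductionFunctor A).map θ
      comm := fun χ => by
        ext1
        change (biproduct.map fun h => (A.F h).map θ) ≫
            diagScale (fun h => (A.F h).obj Y) (fun h => (χ h : k)) =
          diagScale (fun h => (A.F h).obj X) (fun h => (χ h : k)) ≫
            (biproduct.map fun h => (A.F h).map θ)
        apply biproduct.hom_ext
        intro j
        rw [Category.assoc, Category.assoc, diagScale_π, biproduct.map_π, ← Category.assoc,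
          diagScale_π, Linear.comp_smul, biproduct.map_π, Linear.smul_comp] }
  map_id X := by
    ext1
    exact (inductionFunctor A).map_id X
  map_comp a b := by
    ext1
    exact (inductionFunctor A).map_comp a b

instance (A : LinearAction k G C) : (inductionFunctor A).Additive where
  map_add {X Y a b} := by
    ext
    apply biproduct.hom_ext
    intro j
    change (biproduct.map fun h => (A.F h).map (a + b)) ≫ _ =
      ((biproduct.map fun h => (A.F h).map a) + (biproduct.map fun h => (A.F h).map b)) ≫ _
    simp [Functor.map_add]

instance (A : LinearAction k G C) : (comparison A).Additive where
  map_add {X Y a b} := by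
    ext1
    exact (inductionFunctor A).map_add

instance (A : LinearAction k G C) : (comparison A).Linear k where
  map_smul {X Y} a r := by
    ext
    apply biproduct.hom_ext
    intro j
    change (biproduct.map fun h => (A.F h).map (r • a)) ≫ _ =
      (r • (biproduct.map fun h => (A.F h).map a)) ≫ _
    simp [Functor.map_smul]

instance (A : LinearAction k G C) : (comparison A).Faithful where
  map_injective {X Y a b} h := by
    have h1 : (biproduct.map fun h => (A.F h).map a) = (biproduct.map fun h => (A.F h).map b) :=
      congrArg (fun x => x.f.f) h
    have h2 := congrArg (fun x => biproduct.ι _ 1 ≫ x ≫ biproduct.π _ 1) h1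
    refine (A.F 1).map_injective ?_
    simpa using h2

/-- A morphism `Ind X ⟶ Ind Y` compatible with both the `G`-structure and the scalars `χ(h)` is
of the form `⨁_h F_h θ`. -/
theorem exists_eq_map (hG : SplitsOver k G) (A : LinearAction k G C) {X Y : C}
    (f : (⨁ fun h => (A.F h).obj X) ⟶ ⨁ fun h => (A.F h).obj Y)
    (hχ : ∀ χ : G →* kˣ, f ≫ diagScale (fun h => (A.F h).obj Y) (fun h => (χ h : k)) =
      diagScale (fun h => (A.F h).obj X) (fun h => (χ h : k)) ≫ f)
    (hg : ∀ g, f ≫ (indIso A Y g).hom = (indIso A X g).hom ≫ (A.F g).map f) :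
    ∃ θ : X ⟶ Y, (biproduct.map fun h => (A.F h).map θ) = f := by
  -- Compatibility with scalars multiplies the $(h,l)$ entry by $\chi(h)$ and by $\chi(l)$ with
  -- equal results; a character separating $h$ from $l$ makes it vanish.
  have hoff : ∀ h l, h ≠ l → biproduct.ι (fun h => (A.F h).obj X) h ≫ f ≫
      biproduct.π (fun h => (A.F h).obj Y) l = 0 := fun h l hhl => by
    obtain ⟨χ, hne⟩ := exists_character_ne hG hhl
    have := congrArg (fun x => biproduct.ι (fun h => (A.F h).obj X) h ≫ x ≫
      biproduct.π (fun h => (A.F h).obj Y) l) (hχ χ)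
    simp only [Category.assoc, diagScale_π, Linear.comp_smul] at this
    rw [← Category.assoc _ (diagScale _ _), ι_diagScale, Linear.smul_comp] at this
    have h0 := sub_eq_zero.2 this
    rw [← sub_smul] at h0
    exact (smul_eq_zero.1 h0).resolve_left fun h1 => hne (Units.ext (sub_eq_zero.1 h1).symm)
  have hdiag : ∀ l, f ≫ biproduct.π (fun h => (A.F h).obj Y) l =
      biproduct.π (fun h => (A.F h).obj X) l ≫ biproduct.ι (fun h => (A.F h).obj X) l ≫ f ≫
      biproduct.π (fun h => (A.F h).obj Y) l := fun l => by
    apply biproduct.hom_ext'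
    intro h
    by_cases hhl : h = l
    · subst hhl; simp
    · rw [hoff h l hhl, biproduct.ι_π_ne_assoc _ hhl, zero_comp]
  -- $F_1$ need not be the identity functor, so $\theta$ comes from its fullness. Equivariance under
  -- $g$ then determines the diagonal entry at $g\cdot1$ from the one at $1$.
  obtain ⟨θ, hθ⟩ := (A.F 1).map_surjective (biproduct.ι (fun h => (A.F h).obj X) 1 ≫ f ≫
      biproduct.π (fun h => (A.F h).obj Y) 1)
  have hmul : ∀ g, biproduct.ι (fun h => (A.F h).obj X) (g * 1) ≫ f ≫
      biproduct.π (fun h => (A.F h).obj Y) (g * 1) = (A.F (g * 1)).map θ := fun g => by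
    have h1 := congrArg (fun x => biproduct.ι (fun h => (A.F h).obj X) (g * 1) ≫ x ≫
      (A.F g).map (biproduct.π (fun h => (A.F h).obj Y) 1)) (hg g)
    simp only [Category.assoc, indIso_π, ← Functor.map_comp] at h1
    rw [hdiag 1, ← hθ, Functor.map_comp, ← Category.assoc (indIso A X g).hom, indIso_π,
      Category.assoc, biproduct.ι_π_self_assoc, ← Category.assoc f, ← Category.assoc,
      Iso.comp_inv_eq, Category.assoc, A.ε_naturality, Iso.inv_hom_id_assoc] at h1
    exact h1
  refine ⟨θ, ?_⟩
  apply biproduct.hom_ext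
  intro l
  have hl := hmul l
  rw [mul_one] at hl
  rw [hdiag, hl, biproduct.map_π]

theorem comparison_full (hG : SplitsOver k G) (A : LinearAction k G C) :
    (comparison A).Full where
  map_surjective {X Y} a := by
    obtain ⟨θ, hθ⟩ := exists_eq_map hG A a.f.f
      (fun χ => congrArg (fun x => x.f) (a.comm χ)) a.f.comm
    refine ⟨θ, ?_⟩
    ext1
    ext1
    exact hθ

/-- Bi-equivariant objects are induced: the summand of `X` fixed by the characters generates. -/
theorem comparison_essSurj [IsIdempotentComplete C] (hG : SplitsOver k G)
    (A : LinearAction k G C) : (comparison A).EssSurj where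
  mem_essImage Q := by
    classical
    cases nonempty_fintype G
    cases nonempty_fintype (G →* kˣ)
    let P := Q.X
    -- Twisting leaves the underlying object unchanged, so the $\widehat G$-structure amounts to a
    -- representation of $\widehat G$ on one object of $\mathcal C$.
    let b : (G →* kˣ) → (P.X ⟶ P.X) := fun χ => (Q.α χ).hom.f
    have hb : ∀ χ g, b χ ≫ ((χ g⁻¹ : k) • (P.α g).hom) = (P.α g).hom ≫ (A.F g).map (b χ) :=
      fun χ g => (Q.α χ).hom.comm g
    have hmul : ∀ χ ψ, b (χ * ψ) = b χ ≫ b ψ := fun χ ψ => by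
      have h : b (χ * ψ) = b χ ≫ b ψ ≫ 𝟙 P.X :=
        congrArg (fun x => EquivariantObject.Hom.f x) (Q.α_mul χ ψ)
      rwa [Category.comp_id] at h
    -- The cocycle relation makes $b_1$ idempotent, and an invertible idempotent is the identity.
    have hone : b 1 = 𝟙 P.X := by
      let c : P.X ⟶ P.X := (Q.α 1).inv.f
      have h1 : b 1 ≫ c = 𝟙 P.X :=
        congrArg (fun x => EquivariantObject.Hom.f x) (Q.α 1).hom_inv_id
      have h2 : b 1 = b 1 ≫ b 1 := (congrArg b (mul_one 1)).symm.trans (hmul 1 1)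
      have h3 := congrArg (fun x => x ≫ c) h2
      rw [Category.assoc, h1, Category.comp_id] at h3
      exact h3.symm
    have hn : (Nat.card (G →* kˣ) : k) ≠ 0 := by
      rw [card_characters hG]
      exact card_ne_zero hG
    -- The averaging projector onto the $\widehat G$-invariant part, whose image $Y$ is the object
    -- to be induced.
    let e : P.X ⟶ P.X := (Nat.card (G →* kˣ) : k)⁻¹ • ∑ χ, b χ
    have hbe : ∀ χ, b χ ≫ e = e := fun χ => by
      simp only [e, Linear.comp_smul, Preadditive.comp_sum, ← hmul]
      congr 1
      exact Fintype.sum_equiv (Equiv.mulLeft χ) _ _ fun _ => rfl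
    have heb : ∀ χ, e ≫ b χ = e := fun χ => by
      simp only [e, Linear.smul_comp, Preadditive.sum_comp, ← hmul]
      congr 1
      exact Fintype.sum_equiv (Equiv.mulRight χ) _ _ fun _ => rfl
    have hee : e ≫ e = e := by
      have : (∑ χ, b χ) ≫ e = (Nat.card (G →* kˣ) : k) • e := by
        rw [Preadditive.sum_comp, Finset.sum_congr rfl fun χ _ => hbe χ, Finset.sum_const,
          Finset.card_univ, Nat.card_eq_fintype_card, Nat.cast_smul_eq_nsmul]
      change ((Nat.card (G →* kˣ) : k)⁻¹ • ∑ χ, b χ) ≫ e = e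
      rw [Linear.smul_comp, this, smul_smul, inv_mul_cancel₀ hn, one_smul]
    obtain ⟨Y, i, r, hir, hri⟩ := IsIdempotentComplete.idempotents_split P.X e hee
    have hib : ∀ χ, i ≫ b χ = i := fun χ => by
      have : i ≫ (r ≫ i) ≫ b χ = i ≫ r ≫ i := by rw [hri, heb]
      simpa [reassoc_of% hir] using this
    have hbr : ∀ χ, b χ ≫ r = r := fun χ => by
      have : b χ ≫ (r ≫ i) ≫ r = (r ≫ i) ≫ r := by rw [hri, ← Category.assoc, hbe]
      simpa [hir] using this
    -- Under $\alpha_h$, the summand $F_h(Y)$ of $F_h(P)$ corresponds to the part of $P$ where each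
    -- $b_\chi$ acts by $\chi(h)$.
    let p : ∀ h, P.X ⟶ (A.F h).obj Y := fun h => (P.α h).hom ≫ (A.F h).map r
    let q : ∀ h, (A.F h).obj Y ⟶ P.X := fun h => (A.F h).map i ≫ (P.α h).inv
    have hp : ∀ χ h, b χ ≫ p h = (χ h : k) • p h := fun χ h => by
      simp only [p]
      rw [← Category.assoc, comp_α P (hb χ), Linear.smul_comp, Category.assoc, ← Functor.map_comp,
        hbr]
    have hq : ∀ χ h, q h ≫ b χ = (χ h : k) • q h := fun χ h => by
      have h1 : q h = (χ h⁻¹ : k) • (q h ≫ b χ) := by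
        have := α_inv_comp P (hb χ) h
        calc q h = (A.F h).map i ≫ (A.F h).map (b χ) ≫ (P.α h).inv := by
              rw [← Functor.map_comp_assoc, hib]
          _ = _ := by
              rw [this]
              simp [q]
      nth_rw 2 [h1]
      rw [smul_smul]
      simp
    have hqp : ∀ h, q h ≫ p h = 𝟙 _ := fun h => by
      simp [p, q, ← Functor.map_comp, hir]
    have hqp0 : ∀ h l, h ≠ l → q h ≫ p l = 0 := fun h l hhl => by
      obtain ⟨χ, hne⟩ := exists_character_ne hG hhl
      have h1 : (χ h : k) • (q h ≫ p l) = (χ l : k) • (q h ≫ p l) := by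
        rw [← Linear.smul_comp, ← hq, Category.assoc, hp, Linear.comp_smul]
      have h0 := sub_eq_zero.2 h1
      rw [← sub_smul] at h0
      exact (smul_eq_zero.1 h0).resolve_left fun h2 => hne (Units.ext (sub_eq_zero.1 h2))
    -- The sum equals $|\widehat G|^{-1}\sum_\chi\bigl(\sum_h\chi(h^{-1})\bigr)b_\chi$.
    -- Orthogonality leaves only $\chi=1$, with coefficient $|G|/|\widehat G|=1$ in $k$.
    have hpq : ∑ h, p h ≫ q h = 𝟙 P.X := by
      have h1 : ∀ h, p h ≫ q h = (Nat.card (G →* kˣ) : k)⁻¹ • ∑ χ : G →* kˣ,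
          (χ h⁻¹ : k) • b χ := fun h => by
        simp only [p, q, Category.assoc]
        rw [← Functor.map_comp_assoc, hri, Functor.map_smul, Functor.map_sum, Linear.smul_comp,
          Linear.comp_smul, Preadditive.sum_comp, Preadditive.comp_sum]
        congr 1
        refine Finset.sum_congr rfl fun χ _ => ?_
        rw [α_inv_comp P (hb χ), Linear.comp_smul, Iso.hom_inv_id_assoc]
      rw [Finset.sum_congr rfl fun h _ => h1 h, ← Finset.smul_sum, Finset.sum_comm,
        Finset.sum_eq_single 1]
      · simp only [MonoidHom.one_apply, Units.val_one, one_smul, hone, Finset.sum_const,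
          Finset.card_univ]
        rw [← Nat.cast_smul_eq_nsmul k, ← Nat.card_eq_fintype_card, ← card_characters hG, smul_smul,
          inv_mul_cancel₀ hn, one_smul]
      · intro χ _ hχ
        rw [← Finset.sum_smul, show ∑ g, (χ g⁻¹ : k) = ∑ g, (χ g : k) from
          Fintype.sum_equiv (Equiv.inv G) _ _ fun _ => rfl, sum_character_eq_zero hχ, zero_smul]
      · simp
    let E : P.X ≅ ⨁ fun h => (A.F h).obj Y :=
      { hom := biproduct.lift p
        inv := biproduct.desc q
        hom_inv_id := by rw [lift_desc', hpq]
        inv_hom_id := by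
          apply biproduct.hom_ext'
          intro h
          apply biproduct.hom_ext
          intro l
          simp only [biproduct.ι_desc_assoc, Category.assoc, biproduct.lift_π, Category.comp_id]
          by_cases hhl : h = l
          · subst hhl
            rw [hqp, biproduct.ι_π_self]
          · rw [hqp0 h l hhl, biproduct.ι_π_ne _ hhl] }
    let E' : P ≅ indObj A Y := EquivariantObject.mkIso E (fun g => by
      apply hom_ext_map_sum
      intro l
      rw [Category.assoc, indIso_π, Category.assoc, ← Functor.map_comp]
      simp only [E, biproduct.lift_π, biproduct.lift_π_assoc, p, Functor.map_comp]
      rw [P.α_mul, Category.assoc, Category.assoc, Category.assoc]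
      congr 2
      rw [← Category.assoc, Iso.comp_inv_eq, A.ε_naturality])
    refine ⟨Y, ⟨(EquivariantObject.mkIso (P := Q) (Q := (comparison A).obj Y) E' fun χ => ?_).symm⟩⟩
    ext1
    change biproduct.lift p ≫ diagScale (fun h => (A.F h).obj Y) (fun h => (χ h : k)) =
      b χ ≫ biproduct.lift p
    apply biproduct.hom_ext
    intro h
    simp [hp]

/-- The isomorphism `⨁_h F_h F_g X ≅ ⨁_h F_h X` with components `ε_{h,g} : F_h F_g X ≅ F_{hg} X`. -/
@[simps]
def rightShiftIso (A : LinearAction k G C) (g : G) (X : C) :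
    (⨁ fun h => (A.F h).obj ((A.F g).obj X)) ≅ ⨁ fun h => (A.F h).obj X where
  hom := biproduct.desc fun h => (A.ε h g X).hom ≫ biproduct.ι (fun h => (A.F h).obj X) (h * g)
  inv := biproduct.lift fun h => biproduct.π (fun h => (A.F h).obj X) (h * g) ≫ (A.ε h g X).inv
  hom_inv_id := by
    apply biproduct.hom_ext'
    intro i
    apply biproduct.hom_ext
    intro j
    simp only [biproduct.ι_desc_assoc, Category.assoc, biproduct.lift_π, Category.comp_id]
    by_cases hij : i = j
    · subst hij; simp
    · rw [biproduct.ι_π_ne_assoc _ (fun h => hij (mul_right_cancel h)), biproduct.ι_π_ne _ hij]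
      simp
  inv_hom_id := by
    cases nonempty_fintype G
    rw [lift_desc']
    simp only [Category.assoc, Iso.inv_hom_id_assoc]
    rw [← total']
    exact Fintype.sum_equiv (Equiv.mulRight g) _ (fun h => biproduct.π _ h ≫ biproduct.ι _ h)
      (fun h => rfl)

/-- `Ind F_g X ≅ Ind X`. -/
def indShiftIso (A : LinearAction k G C) (g : G) (X : C) :
    indObj A X ≅ indObj A ((A.F g).obj X) :=
  EquivariantObject.mkIso (rightShiftIso A g X).symm (fun a => by
    apply hom_ext_map_sum
    intro l
    rw [Category.assoc, indIso_π, Category.assoc, ← Functor.map_comp]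
    simp only [Iso.symm_hom, rightShiftIso_inv, biproduct.lift_π, biproduct.lift_π_assoc,
      Functor.map_comp, Category.assoc]
    rw [← Category.assoc (indIso A X a).hom, indIso_π, cocycle_inv,
      ← Category.assoc (biproduct.π _ _), biproduct.π_comp_eqToHom (fun h => (A.F h).obj X)
        (mul_assoc a l g), Category.assoc])

/-- The summand $F_hF_gX$ is matched with $F_{hg}X$, where the scalar is $\chi(hg)$ rather than
$\chi(h)$. The discrepancy $\chi(g)^{-1}$ is exactly the twist by evaluation at $g$. -/
theorem rightShiftIso_inv_diagScale (A : LinearAction k G C) (g : G) (X : C) (χ : G →* kˣ) :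
    (rightShiftIso A g X).inv ≫
        diagScale (fun h => (A.F h).obj ((A.F g).obj X)) (fun h => (χ h : k)) =
      (((χ⁻¹ g : kˣ) : k) • diagScale (fun h => (A.F h).obj X) (fun h => (χ h : k))) ≫
        (rightShiftIso A g X).inv := by
  apply biproduct.hom_ext
  intro h
  simp only [Category.assoc, diagScale_π, Linear.smul_comp, Linear.comp_smul, rightShiftIso_inv,
    biproduct.lift_π]
  rw [← Category.assoc, diagScale_π]
  simp [smul_smul, mul_comm]

/-- The comparison functor intertwines `F_g` and the twist by `g`. -/
def comparisonShiftIso (A : LinearAction k G C) (g : G) (X : C) :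
    (comparison A).obj ((A.F g).obj X) ≅ ((bidualAction A).F g).obj ((comparison A).obj X) :=
  (EquivariantObject.mkIso (P := ((bidualAction A).F g).obj ((comparison A).obj X))
    (Q := (comparison A).obj ((A.F g).obj X)) (indShiftIso A g X) (fun χ => by
    ext1
    exact rightShiftIso_inv_diagScale A g X χ)).symm

end Duality

/-! ### Equivariant functors between different categories, and their quasi-inverses. -/

section EquivariantFunctors

variable {k : Type*} [Field k] {G : Type*} [Group G]
  {C : Type*} [Category* C] [Preadditive C] [Linear k C]
  {D : Type*} [Category* D] [Preadditive D] [Linear k D]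
  {E : Type*} [Category* E] [Preadditive E] [Linear k E]

/-- A functor `F` between categories with `G`-action, with coherent natural isomorphisms
`δ_g : F F_g ≅ F_g F`. -/
structure EquivariantFunctor (A : LinearAction k G C) (B : LinearAction k G D) where
  F : C ⥤ D
  δ : ∀ (g : G) (X : C), F.obj ((A.F g).obj X) ≅ (B.F g).obj (F.obj X)
  δ_naturality : ∀ (g : G) {X Y : C} (f : X ⟶ Y),
    F.map ((A.F g).map f) ≫ (δ g Y).hom = (δ g X).hom ≫ (B.F g).map (F.map f)
  δ_mul : ∀ (g h : G) (X : C),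
    F.map (A.ε g h X).hom ≫ (δ (g * h) X).hom =
      (δ g ((A.F h).obj X)).hom ≫ (B.F g).map (δ h X).hom ≫ (B.ε g h (F.obj X)).hom

namespace EquivariantFunctor

variable {A : LinearAction k G C} {B : LinearAction k G D} {B' : LinearAction k G E}

/-- The composite of equivariant functors. -/
def comp (Q : EquivariantFunctor A B) (P : EquivariantFunctor B B') : EquivariantFunctor A B' where
  F := Q.F ⋙ P.F
  δ g X := P.F.mapIso (Q.δ g X) ≪≫ P.δ g (Q.F.obj X)
  δ_naturality g X Y f := by
    have h1 := P.δ_naturality g (Q.F.map f)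
    simp only [Functor.comp_map, Iso.trans_hom, Functor.mapIso_hom, Category.assoc]
    rw [← Functor.map_comp_assoc, Q.δ_naturality, Functor.map_comp_assoc, h1]
  δ_mul g h X := by
    have h1 := P.δ_mul g h (Q.F.obj X)
    have h2 := P.δ_naturality g (Q.δ h X).hom
    simp only [Functor.comp_obj, Functor.comp_map, Iso.trans_hom, Functor.mapIso_hom,
      Functor.map_comp, Category.assoc]
    rw [← Functor.map_comp_assoc, Q.δ_mul]
    simp only [Functor.map_comp, Category.assoc]
    rw [h1, reassoc_of% h2]

variable (P : EquivariantFunctor A B) [P.F.IsEquivalence]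

/-- The counit `F F⁻¹ X ≅ X` of a quasi-inverse. -/
def counit (X : D) : P.F.obj (P.F.inv.obj X) ≅ X :=
  P.F.asEquivalence.counitIso.app X

theorem counit_nat {X Y : D} (f : X ⟶ Y) :
    P.F.map (P.F.inv.map f) ≫ (P.counit Y).hom = (P.counit X).hom ≫ f :=
  P.F.asEquivalence.counitIso.hom.naturality f

/-- The structure isomorphisms of the quasi-inverse of an equivariant equivalence. -/
def invδ (g : G) (X : D) :
    P.F.inv.obj ((B.F g).obj X) ≅ (A.F g).obj (P.F.inv.obj X) :=
  P.F.preimageIso (P.counit ((B.F g).obj X) ≪≫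
    (B.F g).mapIso (P.counit X).symm ≪≫ (P.δ g (P.F.inv.obj X)).symm)

theorem map_invδ (g : G) (X : D) :
    P.F.map (P.invδ g X).hom ≫ (P.δ g (P.F.inv.obj X)).hom ≫ (B.F g).map (P.counit X).hom =
      (P.counit ((B.F g).obj X)).hom := by
  simp [invδ, ← Functor.map_comp]

theorem inv_ext {g : G} {X : D} {Z : C} {a b : Z ⟶ (A.F g).obj (P.F.inv.obj X)}
    (h : P.F.map a ≫ (P.δ g (P.F.inv.obj X)).hom ≫ (B.F g).map (P.counit X).hom =
      P.F.map b ≫ (P.δ g (P.F.inv.obj X)).hom ≫ (B.F g).map (P.counit X).hom) : a = b := by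
  apply P.F.map_injective
  rwa [cancel_mono] at h

/-- The quasi-inverse of an equivariant equivalence. -/
def inv : EquivariantFunctor B A where
  F := P.F.inv
  δ := P.invδ
  δ_naturality g X Y f := by
    apply P.inv_ext
    rw [Functor.map_comp_assoc, map_invδ, Functor.map_comp_assoc,
      reassoc_of% P.δ_naturality g (P.F.inv.map f), ← Functor.map_comp, counit_nat, counit_nat,
      Functor.map_comp, reassoc_of% P.map_invδ g X]
  δ_mul g h X := by
    apply P.inv_ext
    rw [Functor.map_comp_assoc, map_invδ, counit_nat, Functor.map_comp_assoc,
      Functor.map_comp_assoc, reassoc_of% P.δ_mul g h (P.F.inv.obj X), ← B.ε_naturality,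
      reassoc_of% P.δ_naturality g (P.invδ h X).hom, ← Functor.map_comp_assoc,
      ← Functor.map_comp_assoc, Category.assoc, map_invδ, reassoc_of% P.map_invδ g]

theorem quasiInverse_linear [P.F.Linear k] [P.F.Additive] : P.F.inv.Linear k where
  map_smul {X Y} f r := P.F.map_injective (by
    rw [← cancel_mono (P.counit Y).hom, counit_nat, Functor.map_smul, Linear.smul_comp,
      counit_nat, Linear.comp_smul])

theorem quasiInverse_additive [P.F.Additive] : P.F.inv.Additive :=
  haveI : P.F.asEquivalence.functor.Additive := ‹P.F.Additive›
  P.F.asEquivalence.inverse_additive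

end EquivariantFunctor

end EquivariantFunctors

/-! ### Lifting equivariant autoequivalences, and equivariance of the comparison functor. -/

section Lift

variable {k : Type w} [Field k] {G : Type w'} [Group G]
  {C : Type u} [Category.{v} C] [Preadditive C] [Linear k C] {A : LinearAction k G C}

/-- The functor `(X, α) ↦ (F X, δ ∘ F(α))` induced on equivariant objects by an equivariant
autoequivalence `(F, δ)`. -/
def liftFunctor (P : EquivariantAutoequiv A) : EquivariantObject A ⥤ EquivariantObject A where
  obj Q :=
    { X := P.F.obj Q.X
      α := fun g => P.F.mapIso (Q.α g) ≪≫ P.δ g Q.X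
      α_mul := fun g h => by
        have h1 := P.δ_mul g h Q.X
        have h2 := P.δ_naturality g (Q.α h).hom
        simp only [Iso.trans_hom, Functor.mapIso_hom, Q.α_mul, Functor.map_comp, Category.assoc]
        rw [h1, reassoc_of% h2] }
  map {Q R} a :=
    { f := P.F.map a.f
      comm := fun g => by
        have h1 := P.δ_naturality g a.f
        simp only [Iso.trans_hom, Functor.mapIso_hom, Category.assoc]
        rw [← h1, ← Functor.map_comp_assoc, a.comm, Functor.map_comp_assoc] }
  map_id Q := by
    ext1
    exact P.F.map_id Q.X
  map_comp a b := by
    ext1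
    exact P.F.map_comp a.f b.f

instance (P : EquivariantAutoequiv A) : (liftFunctor P).Additive where
  map_add {X Y a b} := by
    ext1
    exact P.F.map_add

instance (P : EquivariantAutoequiv A) : (liftFunctor P).Linear k where
  map_smul {X Y} a r := by
    ext1
    exact P.F.map_smul r a.f

instance (P : EquivariantAutoequiv A) : (liftFunctor P).IsEquivalence where
  faithful := ⟨fun {Q R a b} h => by
    ext1
    exact P.F.map_injective (congrArg (fun a => EquivariantObject.Hom.f a) h)⟩
  full := ⟨fun {Q R} b => by
    obtain ⟨f, hf⟩ := P.F.map_surjective b.f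
    refine ⟨⟨f, fun g => P.F.map_injective ?_⟩, EquivariantObject.hom_ext hf⟩
    have h1 := P.δ_naturality g f
    have h2 : ∀ c : P.F.obj Q.X ⟶ P.F.obj R.X, c = b.f →
        c ≫ P.F.map (R.α g).hom ≫ (P.δ g R.X).hom =
          (P.F.map (Q.α g).hom ≫ (P.δ g Q.X).hom) ≫ (A.F g).map c := by
      rintro _ rfl
      exact b.comm g
    replace h2 := h2 _ hf
    rw [Category.assoc, ← h1] at h2
    rw [← cancel_mono (P.δ g R.X).hom]
    simpa using h2⟩
  essSurj := ⟨fun Q => by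
    -- The lift of the quasi-inverse supplies a preimage; the counit is an equivariant map by the
    -- defining property of `invδ`.
    let Q' := (liftFunctor P.inv).obj Q
    refine ⟨Q', ⟨EquivariantObject.mkIso (P := (liftFunctor P).obj Q') (Q := Q)
      (P.counit Q.X) fun g => ?_⟩⟩
    have h1 := P.map_invδ g Q.X
    have h2 := P.counit_nat (Q.α g).hom
    change _ = (P.F.map (P.F.inv.map (Q.α g).hom ≫ (P.invδ g Q.X).hom) ≫
      (P.δ g (P.F.inv.obj Q.X)).hom) ≫ (A.F g).map (P.counit Q.X).hom
    rw [Functor.map_comp, Category.assoc, Category.assoc, h1]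
    exact h2.symm⟩

/-- The functor induced by an equivariant autoequivalence commutes with twists. -/
def liftTwistIso (P : EquivariantAutoequiv A) (χ : G →* kˣ) (Q : EquivariantObject A) :
    (liftFunctor P).obj ((twist A χ).obj Q) ≅ (twist A χ).obj ((liftFunctor P).obj Q) :=
  EquivariantObject.mkIso (P := (liftFunctor P).obj ((twist A χ).obj Q))
    (Q := (twist A χ).obj ((liftFunctor P).obj Q)) (Iso.refl (P.F.obj Q.X)) fun g => by
      have h : 𝟙 (P.F.obj Q.X) ≫ ((χ g⁻¹ : k) • (P.F.map (Q.α g).hom ≫ (P.δ g Q.X).hom)) =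
          (P.F.map ((χ g⁻¹ : k) • (Q.α g).hom) ≫ (P.δ g Q.X).hom) ≫
            (A.F g).map (𝟙 (P.F.obj Q.X)) := by
        simp [Functor.map_smul]
      exact h

/-- An equivariant autoequivalence of `C` induces one of the category of equivariant objects with
the dual action. -/
def liftAutoequiv (P : EquivariantAutoequiv A) : EquivariantAutoequiv (dualAction A) where
  F := liftFunctor P
  additive := inferInstance
  linear := inferInstance
  isEquivalence := inferInstance
  δ := liftTwistIso P
  δ_naturality χ X Y f := by
    ext1
    exact (Category.comp_id (P.F.map f.f)).trans (Category.id_comp (P.F.map f.f)).symm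
  δ_mul χ ψ X := by
    ext1
    have h : P.F.map (𝟙 X.X) ≫ 𝟙 (P.F.obj X.X) =
      𝟙 (P.F.obj X.X) ≫ 𝟙 (P.F.obj X.X) ≫ 𝟙 (P.F.obj X.X) := by simp
    exact h

/-- The functor induced by an equivariant autoequivalence, as an equivariant functor for any group
acting by twists. -/
def liftEquivariantFunctor (P : EquivariantAutoequiv A) {K : Type*} [Group K]
    (φ : K →* G →* kˣ) : EquivariantFunctor (twistAction A φ) (twistAction A φ) where
  F := liftFunctor P
  δ x := liftTwistIso P (φ x)
  δ_naturality x X Y f := by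
    ext1
    exact (Category.comp_id (P.F.map f.f)).trans (Category.id_comp (P.F.map f.f)).symm
  δ_mul x y X := by
    ext1
    have h : P.F.map (𝟙 X.X) ≫ 𝟙 (P.F.obj X.X) =
      𝟙 (P.F.obj X.X) ≫ 𝟙 (P.F.obj X.X) ≫ 𝟙 (P.F.obj X.X) := by simp
    exact h

variable [HasFiniteBiproducts C] [Finite G]

/-- The isomorphism `F (⨁_h F_h X) ≅ ⨁_h F_h F X`. -/
def mapIndIso (P : EquivariantAutoequiv A) (X : C) :
    P.F.obj (⨁ fun h => (A.F h).obj X) ≅ ⨁ fun h => (A.F h).obj (P.F.obj X) :=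
  mapSumIso P.F (fun h => (A.F h).obj X) ≪≫ biproduct.mapIso fun h => P.δ h X

theorem mapIndIso_hom_π (P : EquivariantAutoequiv A) (X : C) (l : G) :
    (mapIndIso P X).hom ≫ biproduct.π (fun h => (A.F h).obj (P.F.obj X)) l =
      P.F.map (biproduct.π (fun h => (A.F h).obj X) l) ≫ (P.δ l X).hom := by
  simp [mapIndIso]

/-- On each component this is the coherence `δ_mul` for the pair $(g,l)$, with both $\varepsilon$
inverted. -/
theorem mapIndIso_hom_comm (P : EquivariantAutoequiv A) (X : C) (g : G) :
    (mapIndIso P X).hom ≫ (indIso A (P.F.obj X) g).hom =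
      (P.F.map (indIso A X g).hom ≫ (P.δ g (⨁ fun h => (A.F h).obj X)).hom) ≫
        (A.F g).map (mapIndIso P X).hom := by
  apply hom_ext_map_sum
  intro l
  have h1 := P.δ_mul g l X
  have h2 := P.δ_naturality g (biproduct.π (fun h => (A.F h).obj X) l)
  have h3 : (P.δ (g * l) X).hom ≫ (A.ε g l (P.F.obj X)).inv =
      P.F.map (A.ε g l X).inv ≫ (P.δ g ((A.F l).obj X)).hom ≫ (A.F g).map (P.δ l X).hom := by
    rw [Iso.comp_inv_eq, Category.assoc, Category.assoc, ← h1, ← Functor.map_comp_assoc,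
      Iso.inv_hom_id, CategoryTheory.Functor.map_id, Category.id_comp]
  rw [Category.assoc, indIso_π, ← Category.assoc, mapIndIso_hom_π, Category.assoc, h3,
    Category.assoc, Category.assoc, ← Functor.map_comp, mapIndIso_hom_π, Functor.map_comp,
    ← reassoc_of% h2, ← Functor.map_comp_assoc, ← Functor.map_comp_assoc, indIso_π]

/-- `F^G Ind X ≅ Ind F X`. -/
def indLiftIso (P : EquivariantAutoequiv A) (X : C) :
    (liftFunctor P).obj (indObj A X) ≅ indObj A (P.F.obj X) :=
  EquivariantObject.mkIso (P := (liftFunctor P).obj (indObj A X)) (Q := indObj A (P.F.obj X))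
    (mapIndIso P X) (mapIndIso_hom_comm P X)

/-- The comparison functor as an equivariant functor. -/
def comparisonEquivariant (A : LinearAction k G C) : EquivariantFunctor A (bidualAction A) where
  F := comparison A
  δ := comparisonShiftIso A
  δ_naturality g X Y f := by
    ext1
    ext1
    have h : (biproduct.map fun h => (A.F h).map ((A.F g).map f)) ≫ (rightShiftIso A g Y).hom =
        (rightShiftIso A g X).hom ≫ (biproduct.map fun h => (A.F h).map f) := by
      apply biproduct.hom_ext'
      intro h
      rw [biproduct.ι_map_assoc, rightShiftIso_hom, rightShiftIso_hom, biproduct.ι_desc,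
        biproduct.ι_desc_assoc, Category.assoc, biproduct.ι_map, reassoc_of% A.ε_naturality]
    exact h
  δ_mul g h X := by
    ext1
    ext1
    have h : (biproduct.map fun l => (A.F l).map (A.ε g h X).hom) ≫
          (rightShiftIso A (g * h) X).hom =
        (rightShiftIso A g ((A.F h).obj X)).hom ≫ (rightShiftIso A h X).hom ≫ 𝟙 _ := by
      rw [Category.comp_id]
      apply biproduct.hom_ext'
      intro l
      rw [biproduct.ι_map_assoc, rightShiftIso_hom, rightShiftIso_hom, rightShiftIso_hom,
        biproduct.ι_desc, biproduct.ι_desc_assoc, Category.assoc, biproduct.ι_desc,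
        ← reassoc_of% A.cocycle l g h X]
      rw [biproduct.eqToHom_comp_ι (fun h => (A.F h).obj X) (mul_assoc l g h)]
    exact h

end Lift

/-! ### Induction on stable objects and on autoequivalences. -/

section Correspondence

variable {k : Type w} [Field k] {G : Type w'} [Group G]
  {C : Type u} [Category.{v} C] [Preadditive C] [Linear k C] {A : LinearAction k G C}

/-- The functor forgetting the equivariant structure. -/
def forget (A : LinearAction k G C) : EquivariantObject A ⥤ C where
  obj P := P.X
  map a := a.f

instance (A : LinearAction k G C) : (forget A).Additive where
  map_add := rfl

variable [HasFiniteBiproducts C]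

/-- $F_g(M)$ and $M$ are both basic and generate the same subcategory, so stability passes from any
generator to the basic one. -/
theorem isStable_of_addClosure_eq [IsIdempotentComplete C]
    (homFinite : ∀ X Y : C, Module.Finite k (X ⟶ Y)) {M T : C} (hM : IsBasic M)
    (hT : IsStable A T) (h : addClosure M = addClosure T) : IsStable A M := fun g =>
  nonempty_iso_of_addClosure_eq homFinite (isBasic_map (A.F g) hM) hM (by
    obtain ⟨e⟩ := hT g
    rw [addClosure_map_eq (A.F g) h, addClosure_eq_of_iso e, h])

variable [Finite G]

theorem addClosure_sum_of_isStable {M : C} (hM : IsStable A M) :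
    addClosure (⨁ fun g => (A.F g).obj M) = addClosure M :=
  addClosure_eq
    (addClosure_biproduct _ fun g => addClosure_of_iso (hM g).some)
    (addClosure_trans (addClosure_of_iso (hM 1).some.symm)
      (addClosure_component (fun g => (A.F g).obj M) 1))

theorem isStable_sum (A : LinearAction k G C) (X : C) :
    IsStable A (⨁ fun g => (A.F g).obj X) := fun g => ⟨(indIso A X g).symm⟩

theorem isStable_ind (A : LinearAction k G C) (X : C) :
    IsStable (dualAction A) (indObj A X) := fun χ => ⟨(indTwistIso A X χ).symm⟩

/-- Since $\mathrm{Ind}\,F_gX\simeq\mathrm{Ind}\,X$, an arbitrary $X$ may be replaced by the stable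
object $\bigoplus_gF_gX$. -/
theorem addClosure_ind_sum (A : LinearAction k G C) (X : C) :
    addClosure ((inductionFunctor A).obj (⨁ fun g => (A.F g).obj X)) =
      addClosure ((inductionFunctor A).obj X) :=
  addClosure_eq
    (addClosure_trans (addClosure_of_iso (mapSumIso (inductionFunctor A) _))
      (addClosure_biproduct _ fun g => addClosure_of_iso (indShiftIso A g X).symm))
    (addClosure_trans (addClosure_of_iso (indShiftIso A 1 X))
      (addClosure_map (inductionFunctor A) (addClosure_component (fun g => (A.F g).obj X) 1)))

theorem addClosure_liftAutoequiv (P : EquivariantAutoequiv A) {M : C} {N : EquivariantObject A}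
    (h : addClosure N = addClosure ((inductionFunctor A).obj M)) :
    addClosure ((liftAutoequiv P).F.obj N) = addClosure ((inductionFunctor A).obj (P.F.obj M)) :=
  (addClosure_map_eq (liftFunctor P) h).trans (addClosure_eq_of_iso (indLiftIso P M))

variable [IsIdempotentComplete C]

theorem exists_dual_basicStable (homFinite : ∀ X Y : C, Module.Finite k (X ⟶ Y))
    (M : BasicStable A) : ∃ N : BasicStable (dualAction A),
    addClosure N.1 = addClosure ((inductionFunctor A).obj M.1) := by
  have hf := homFinite_equivariant homFinite A
  obtain ⟨N, hN, h⟩ := exists_isBasic hf ((inductionFunctor A).obj M.1)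
  exact ⟨⟨N, hN, isStable_of_addClosure_eq hf hN (isStable_ind A M.1) h⟩, h⟩

theorem exists_primal_basicStable (homFinite : ∀ X Y : C, Module.Finite k (X ⟶ Y))
    (hG : SplitsOver k G) (N : BasicStable (dualAction A)) :
    ∃ M : BasicStable A, addClosure N.1 = addClosure ((inductionFunctor A).obj M.1) := by
  have := comparison_essSurj hG A
  -- $Y$ need not be stable or basic: $M$ is the basic object generating the same subcategory as
  -- $\bigoplus_gF_gY$.
  let Y := (comparison A).objPreimage (indObj (dualAction A) N.1)
  let e : (inductionFunctor A).obj Y ≅ ⨁ fun χ => ((dualAction A).F χ).obj N.1 :=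
    (forget (dualAction A)).mapIso ((comparison A).objObjPreimageIso (indObj (dualAction A) N.1))
  obtain ⟨M, hM, h⟩ := exists_isBasic homFinite (⨁ fun g => (A.F g).obj Y)
  refine ⟨⟨M, hM, isStable_of_addClosure_eq homFinite hM (isStable_sum A Y) h⟩, ?_⟩
  rw [addClosure_map_eq (inductionFunctor A) h, addClosure_ind_sum, addClosure_eq_of_iso e,
    addClosure_sum_of_isStable N.2.2]

/-- Forgetting the equivariant structure turns $\mathrm{Ind}(M)$ into $\bigoplus_gF_g(M)$, which
recovers $\mathrm{add}\,M$ for stable $M$. -/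
theorem nonempty_iso_of_addClosure_ind_eq (homFinite : ∀ X Y : C, Module.Finite k (X ⟶ Y))
    {M M' : BasicStable A}
    (h : addClosure ((inductionFunctor A).obj M.1) = addClosure ((inductionFunctor A).obj M'.1)) :
    Nonempty (M.1 ≅ M'.1) := by
  have h1 : addClosure (⨁ fun g => (A.F g).obj M.1) = addClosure (⨁ fun g => (A.F g).obj M'.1) :=
    addClosure_map_eq (forget A) h
  rw [addClosure_sum_of_isStable M.2.2, addClosure_sum_of_isStable M'.2.2] at h1
  exact nonempty_iso_of_addClosure_eq homFinite M.2.1 M'.2.1 h1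

/-- Every equivariant autoequivalence for the dual action is induced, up to isomorphism on induced
objects, by an equivariant autoequivalence of the original category. -/
theorem exists_autoequiv_of_dual (hG : SplitsOver k G) (E : EquivariantAutoequiv (dualAction A)) :
    ∃ P : EquivariantAutoequiv A, ∀ X, Nonempty
      ((inductionFunctor A).obj (P.F.obj X) ≅ E.F.obj ((inductionFunctor A).obj X)) := by
  have := comparison_full hG A
  have := comparison_essSurj hG A
  have : (comparison A).IsEquivalence := {}
  let K := comparisonEquivariant A
  have hK : K.F.IsEquivalence := this
  have hadd : K.F.Additive := inferInstanceAs (comparison A).Additive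
  have hlin : K.F.Linear k := inferInstanceAs ((comparison A).Linear k)
  have := K.quasiInverse_additive
  have := K.quasiInverse_linear
  -- The lift of $E$ to $(\mathcal C^G)^{\widehat G}$, conjugated by the duality. The counit of $K$,
  -- after forgetting the $\widehat G$-structure, becomes $\mathrm{Ind}\,P\simeq E\,\mathrm{Ind}$.
  let Q := (K.comp (liftEquivariantFunctor E MonoidHom.eval)).comp K.inv
  let P : EquivariantAutoequiv A :=
    { F := (comparison A ⋙ liftFunctor E) ⋙ K.F.inv
      additive := inferInstance
      linear := inferInstance
      isEquivalence := inferInstance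
      δ := Q.δ
      δ_naturality := Q.δ_naturality
      δ_mul := Q.δ_mul }
  exact ⟨P, fun X => ⟨(forget (dualAction A)).mapIso
    (K.counit ((liftFunctor E).obj ((comparison A).obj X)))⟩⟩

end Correspondence

end Equivariantization

end

/-! ### The bijection on stable objects and on orbits. -/

open Equivariantization in
theorem proposition5p8 {k : Type w} [Field k] {C : Type u} [Category.{v} C] [Preadditive C]
    [Linear k C] [HasFiniteBiproducts C] [IsIdempotentComplete C]
    (homFinite : ∀ X Y : C, Module.Finite k (X ⟶ Y))
    {G : Type w'} [CommGroup G] [Finite G] (hG : SplitsOver k G) (A : LinearAction k G C) :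
    ∃ ι : Stab A ≃ Stab (dualAction A),
      (∀ (M : BasicStable A) (N : BasicStable (dualAction A)),
        ι (Quotient.mk _ M) = Quotient.mk _ N → addClosure N.1 = addClosure ((inductionFunctor A).obj M.1)) ∧
      ∃ κ : MulAction.orbitRel.Quotient (EquivariantAut A) (Stab A) ≃
          MulAction.orbitRel.Quotient (EquivariantAut (dualAction A)) (Stab (dualAction A)),
        ∀ x : Stab A, κ (Quotient.mk _ x) = Quotient.mk _ (ι x) := by
  have hf := homFinite_equivariant homFinite A
  have iso_iff : ∀ N N' : BasicStable (dualAction A),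
      N ≈ N' ↔ addClosure N.1 = addClosure N'.1 := fun N N' =>
    ⟨fun ⟨e⟩ => addClosure_eq_of_iso e, fun h => nonempty_iso_of_addClosure_eq hf N.2.1 N'.2.1 h⟩
  have ind_iff : ∀ M M' : BasicStable A, M ≈ M' ↔ addClosure ((inductionFunctor A).obj M.1) =
      addClosure ((inductionFunctor A).obj M'.1) := fun M M' =>
    ⟨fun ⟨e⟩ => addClosure_eq_of_iso ((inductionFunctor A).mapIso e),
      fun h => nonempty_iso_of_addClosure_ind_eq homFinite h⟩
  choose f hfM using fun M : BasicStable A => exists_dual_basicStable homFinite M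
  have f_iff : ∀ M M', f M ≈ f M' ↔ M ≈ M' := fun M M' => by
    rw [iso_iff, ind_iff, hfM, hfM]
  let φ : Stab A → Stab (dualAction A) :=
    Quotient.map f fun M M' h => (f_iff M M').2 h
  have φ_bij : Function.Bijective φ := by
    refine ⟨?_, ?_⟩
    · rintro ⟨M⟩ ⟨M'⟩ h
      exact Quotient.sound ((f_iff M M').1 (Quotient.exact h))
    · rintro ⟨N⟩
      obtain ⟨M, hM⟩ := exists_primal_basicStable homFinite hG N
      exact ⟨Quotient.mk _ M, Quotient.sound ((iso_iff _ _).2 ((hfM M).trans hM.symm))⟩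
  let ι : Stab A ≃ Stab (dualAction A) := Equiv.ofBijective φ φ_bij
  -- This characterization of $\iota$ makes orbit compatibility a comparison of additive closures,
  -- carried by the lift of $P$ in one direction and by the descent of $E$ in the other.
  have hι : ∀ (M : BasicStable A) (N : BasicStable (dualAction A)),
      ι (Quotient.mk _ M) = Quotient.mk _ N ↔
        addClosure N.1 = addClosure ((inductionFunctor A).obj M.1) := fun M N => by
    rw [← hfM, eq_comm (a := addClosure N.1), ← iso_iff]
    exact Quotient.eq
  refine ⟨ι, fun M N => (hι M N).1, Quotient.congr ι ?_, fun x => rfl⟩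
  rintro ⟨M⟩ ⟨M'⟩
  constructor
  · rintro ⟨⟨P⟩, hP⟩
    have h1 : (P.F.obj M'.1 ≅ M.1) := (Quotient.exact hP : BasicStable.map P M' ≈ M).some
    refine ⟨Quotient.mk _ (liftAutoequiv P), ?_⟩
    symm
    refine (hι M (BasicStable.map (liftAutoequiv P) (f M'))).2 ?_
    exact (addClosure_liftAutoequiv P (hfM M')).trans
      (addClosure_eq_of_iso ((inductionFunctor A).mapIso h1))
  · rintro ⟨⟨E⟩, hE⟩
    obtain ⟨P, hP⟩ := exists_autoequiv_of_dual hG E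
    have h1 : (E.F.obj (f M').1 ≅ (f M).1) :=
      (Quotient.exact hE : BasicStable.map E (f M') ≈ f M).some
    refine ⟨Quotient.mk _ P, Quotient.sound (?_ : BasicStable.map P M' ≈ M)⟩
    rw [ind_iff, ← hfM M, ← addClosure_eq_of_iso h1, addClosure_map_eq E.F (hfM M')]
    exact addClosure_eq_of_iso (hP M'.1).some
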